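/- For $m\in\mathbb N=\{0,1,2,\dots\}$ let $P_m$ be the complex vector space of homogeneous polynomials of degree $m$ in $x=(x_1,x_2)$, with the inner product $\langle x_1^lx_2^{m-l},x_1^kx_2^{m-k}\rangle=l!\,(m-l)!\,\delta_{lk}$, and let $\rho_m$ be the (irreducible, unitary) representation of $SU(2)$ on $P_m$ given by $(\rho_m(g)f)(x)=f(xg)$, where $x$ is a row vector. Let $QC(\rho_r,\rho_m)$ be the set of $SU(2)$-irreducibly covariant channels $End(P_r)\to End(P_m)$, i.e. of all completely positive, trace preserving linear maps $\Phi:End(P_r)\to End(P_m)$ with $\Phi(\rho_r(g)A\rho_r(g)^*)=\rho_m(g)\Phi(A)\rho_m(g)^*$ for all $g\in SU(2)$ and $A\in End(P_r)$. Identify $P_m\otimes P_n$ with the space of polynomials in $x=(x_1,x_2)$, $y=(y_1,y_2)$ of bidegree $(m,n)$ by $f\otimes g\mapsto f(x)g(y)$, and give it the tensor product inner product. Put $\Gamma_{xy}F=(x_1y_2-y_1x_2)F$ and $\Delta_{yx}F=\bigl(y_1\frac{\partial}{\partial x_1}+y_2\frac{\partial}{\partial x_2}\bigr)F$. For $0\le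 h\le\min\{m,n\}$ let $c_{m,n,h}>0$ be defined by $c_{m,0,0}=1$ and, for $n\ge1$, $$(m+1)\,n\,c_{m,n,h}=\begin{cases}c_{m+1,n-1,0}&h=0,\\ c_{m-1,n-1,h-1}+c_{m+1,n-1,h}&0<h<n,\\ c_{m-1,n-1,h-1}&h=n\end{cases}$$ Define $$\alpha_{m,n,h}:P_{m+n-2h}\to P_m\otimes P_n,\quad \alpha_{m,n,h}(f)=\sqrt{c_{m,n,h}}\;\Gamma_{xy}^{h}\Delta_{yx}^{n-h}f(x),$$ $$\Phi_{m,n,h}:End(P_{m+n-2h})\to End(P_m),\quad \Phi_{m,n,h}(A)=\mathrm{Tr}_{P_n}\bigl(\alpha_{m,n,h}A\,\alpha_{m,n,h}^*\bigr),$$ where $\mathrm{Tr}_{P_n}$ is the partial trace over $P_n$. The EPOSIC channels from $End(P_r)$ to $End(P_m)$ are the maps $\Phi_{m,n,h}$ with $n,h\in\mathbb N$, $0\le h\le\min\{m,n\}$ and $r=m+n-2h$; let $EC(r,m)$ be the set of them. Proposition 4.1. Let $r,m\in\mathbb N$. The set $QC(\rho_r,\rho_m)$ is convex, and the set of its extreme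 points is $$EC(r,m)=\{\Phi_{m,\,r+m-2l,\,m-l}:0\le l\le\min\{r,m\}\}.$$ Moreover the $\min\{r,m\}+1$ maps $\Phi_{m,\,r+m-2l,\,m-l}$, $0\le l\le\min\{r,m\}$, are affinely independent over $\mathbb R$ and $QC(\rho_r,\rho_m)$ is their convex hull; that is, $QC(\rho_r,\rho_m)$ is a simplex with $\min\{r,m\}+1$ vertices. -/

import Mathlib

namespace EPOSIC

open MvPolynomial TensorProduct
open scoped ComplexOrder

noncomputable section

/-! ### Completely positive maps, covariant channels, partial trace -/

/-- `Φ : End(H) → End(K)` is completely positive: for every `k`, applying `Φ` entrywise to a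
positive `k × k` block operator `(A i j)` on `H^k` gives a positive block operator on `K^k`.
(A block operator `A` is positive if `⟨v, A v⟩ = ∑ i j, ⟨v i, A i j (v j)⟩ ≥ 0` for all `v`;
`0 ≤ z` for a complex number `z` means that `z` is real and nonnegative.) -/
def IsCompletelyPositive {H K : Type*}
    [NormedAddCommGroup H] [InnerProductSpace ℂ H] [NormedAddCommGroup K] [InnerProductSpace ℂ K]
    (Φ : Module.End ℂ H →ₗ[ℂ] Module.End ℂ K) : Prop :=
  ∀ (k : ℕ) (A : Fin k → Fin k → Module.End ℂ H),
    (∀ v : Fin k → H, 0 ≤ ∑ i, ∑ j, inner ℂ (v i) (A i j (v j))) →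
    ∀ w : Fin k → K, 0 ≤ ∑ i, ∑ j, inner ℂ (w i) (Φ (A i j) (w j))

/-- A quantum channel: a completely positive trace preserving linear map. -/
def IsQuantumChannel {H K : Type*}
    [NormedAddCommGroup H] [InnerProductSpace ℂ H] [NormedAddCommGroup K] [InnerProductSpace ℂ K]
    (Φ : Module.End ℂ H →ₗ[ℂ] Module.End ℂ K) : Prop :=
  IsCompletelyPositive Φ ∧ ∀ A, LinearMap.trace ℂ K (Φ A) = LinearMap.trace ℂ H A

/-- The set of `G`-covariant quantum channels `End(H) → End(K)`. -/
def covariantChannels {G H K : Type*} [Group G]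
    [NormedAddCommGroup H] [InnerProductSpace ℂ H] [FiniteDimensional ℂ H]
    [NormedAddCommGroup K] [InnerProductSpace ℂ K] [FiniteDimensional ℂ K]
    (πH : Representation ℂ G H) (πK : Representation ℂ G K) :
    Set (Module.End ℂ H →ₗ[ℂ] Module.End ℂ K) :=
  {Φ | IsQuantumChannel Φ ∧ ∀ (g : G) (A : Module.End ℂ H),
    Φ (πH g ∘ₗ A ∘ₗ LinearMap.adjoint (πH g)) = πK g ∘ₗ Φ A ∘ₗ LinearMap.adjoint (πK g)}

/-- The partial trace `Tr_E : End(K ⊗ E) → End(K)`, i.e. the linear map with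
`A ⊗ B ↦ tr(B) A` under `End(K) ⊗ End(E) ≃ End(K ⊗ E)`. -/
def partialTrace (K E : Type*) [AddCommGroup K] [Module ℂ K] [FiniteDimensional ℂ K]
    [AddCommGroup E] [Module ℂ E] [FiniteDimensional ℂ E] :
    Module.End ℂ (K ⊗[ℂ] E) →ₗ[ℂ] Module.End ℂ K :=
  (TensorProduct.rid ℂ (Module.End ℂ K)).toLinearMap ∘ₗ
    (LinearMap.trace ℂ E).lTensor (Module.End ℂ K) ∘ₗ
    (homTensorHomEquiv ℂ K E K E).symm.toLinearMap

theorem partialTrace_map (K E : Type*) [AddCommGroup K] [Module ℂ K] [FiniteDimensional ℂ K]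
    [AddCommGroup E] [Module ℂ E] [FiniteDimensional ℂ E]
    (A : Module.End ℂ K) (B : Module.End ℂ E) :
    partialTrace K E (TensorProduct.map A B) = LinearMap.trace ℂ E B • A := by
  have h : (homTensorHomEquiv ℂ K E K E).symm (TensorProduct.map A B) = A ⊗ₜ B := by
    rw [LinearEquiv.symm_apply_eq]; simp [homTensorHomEquiv_apply]
  simp [partialTrace, h]

/-! ### The spaces `P_m` and the representations `ρ_m` of `SU(2)` -/

/-- `P_m`: homogeneous polynomials of degree `m` in two variables (`x₁ = X 0`, `x₂ = X 1`). -/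
abbrev P (m : ℕ) : Type := ↥(homogeneousSubmodule (Fin 2) ℂ m)

/-- The exponent vector of `x₁ ^ i * x₂ ^ j`. -/
def expo (i j : ℕ) : Fin 2 →₀ ℕ := Finsupp.single 0 i + Finsupp.single 1 j

theorem expo_degree (i j : ℕ) : (expo i j).degree = i + j := by
  simp [expo, Finsupp.degree_eq_sum]

theorem eq_expo (d : Fin 2 →₀ ℕ) : d = expo (d 0) (d 1) := by
  ext i; fin_cases i <;> simp [expo]

/-- The monomial `x₁ ^ l * x₂ ^ (m - l)`, `0 ≤ l ≤ m`, as an element of `P_m`. -/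
def mono (m : ℕ) (l : Fin (m + 1)) : P m :=
  ⟨monomial (expo l (m - l)) 1, by
    rw [mem_homogeneousSubmodule]
    apply isHomogeneous_monomial
    rw [expo_degree]; omega⟩

/-- The coefficient of `x₁ ^ l * x₂ ^ (m - l)`. -/
def coef (m : ℕ) (l : Fin (m + 1)) : P m →ₗ[ℂ] ℂ :=
  lcoeff ℂ (expo l (m - l)) ∘ₗ (homogeneousSubmodule (Fin 2) ℂ m).subtype

theorem eq_zero_of_coef (m : ℕ) (f : P m) (h : ∀ l, coef m l f = 0) : f = 0 := by
  apply Subtype.ext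
  ext d
  by_cases hd : d.degree = m
  · have h1 : d 0 + d 1 = m := by rw [← hd]; simp [Finsupp.degree_eq_sum]
    have h2 := h ⟨d 0, by omega⟩
    have h3 : m - d 0 = d 1 := by omega
    simp only [coef, LinearMap.comp_apply, Submodule.subtype_apply, lcoeff_apply, h3] at h2
    rw [eq_expo d]
    simpa using h2
  · simpa using f.2.coeff_eq_zero hd

instance (m : ℕ) : FiniteDimensional ℂ (P m) :=
  Module.Finite.of_injective
    (LinearMap.pi (coef m))
    (by
      rw [← LinearMap.ker_eq_bot, LinearMap.ker_eq_bot']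
      intro f hf
      exact eq_zero_of_coef m f fun l => congrFun hf l)

/-- The inner product on `P_m` (conjugate linear in the first variable) with
`⟨x₁^l x₂^(m-l), x₁^k x₂^(m-k)⟩ = l! (m-l)! δ_{lk}`. -/
@[reducible] def innerCore (m : ℕ) : InnerProductSpace.Core ℂ (P m) where
  inner f g := ∑ l : Fin (m + 1),
    ((l : ℕ).factorial * (m - l).factorial : ℂ) * (starRingEnd ℂ (coef m l f) * coef m l g)
  conj_inner_symm f g := by
    simp only [map_sum, map_mul, RingHomCompTriple.comp_apply, RingHom.id_apply, map_natCast]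
    exact Finset.sum_congr rfl fun l _ => by ring
  re_inner_nonneg f := by
    rw [map_sum]
    refine Finset.sum_nonneg fun l _ => ?_
    rw [← Complex.normSq_eq_conj_mul_self]
    have : ((l : ℕ).factorial * (m - l).factorial : ℂ) * (Complex.normSq (coef m l f) : ℂ)
      = (((l : ℕ).factorial * (m - l).factorial * Complex.normSq (coef m l f) : ℝ) : ℂ) := by
      push_cast; ring
    rw [this]
    simp only [RCLike.re_to_complex, Complex.ofReal_re]
    have := Complex.normSq_nonneg (coef m l f)
    positivity
  add_left f g h := by
    simp only [map_add, ← Finset.sum_add_distrib]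
    exact Finset.sum_congr rfl fun l _ => by ring
  smul_left f g a := by
    simp only [map_smul, smul_eq_mul, map_mul, Finset.mul_sum]
    exact Finset.sum_congr rfl fun l _ => by ring
  definite f hf := by
    apply eq_zero_of_coef
    have h1 : ∑ l : Fin (m + 1),
        ((l : ℕ).factorial * (m - l).factorial * Complex.normSq (coef m l f) : ℝ) = 0 := by
      have h2 : ((∑ l : Fin (m + 1),
        ((l : ℕ).factorial * (m - l).factorial * Complex.normSq (coef m l f) : ℝ) : ℝ) : ℂ) = 0 := by
        rw [← hf, Complex.ofReal_sum]
        refine Finset.sum_congr rfl fun l _ => ?_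
        rw [← Complex.normSq_eq_conj_mul_self]; push_cast; ring
      exact_mod_cast h2
    rw [Finset.sum_eq_zero_iff_of_nonneg
      (fun l _ => mul_nonneg (by positivity) (Complex.normSq_nonneg _))] at h1
    intro l
    have h3 := h1 l (Finset.mem_univ _)
    have h4 : ((l : ℕ).factorial * (m - l).factorial : ℝ) ≠ 0 := by positivity
    exact Complex.normSq_eq_zero.mp ((mul_eq_zero.mp h3).resolve_left h4)

instance (m : ℕ) : NormedAddCommGroup (P m) := (innerCore m).toNormedAddCommGroup

instance (m : ℕ) : InnerProductSpace ℂ (P m) := InnerProductSpace.ofCore (innerCore m).toCore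

/-- `SU(2)`. -/
abbrev SU2 : Type := ↥(Matrix.specialUnitaryGroup (Fin 2) ℂ)

/-- The substitution `f(x) ↦ f(x g)`, where `x = (x₁, x₂)` is a row vector. -/
def subst (g : Matrix (Fin 2) (Fin 2) ℂ) : MvPolynomial (Fin 2) ℂ →ₐ[ℂ] MvPolynomial (Fin 2) ℂ :=
  aeval fun j => ∑ i, C (g i j) * X i

theorem subst_mem (g : Matrix (Fin 2) (Fin 2) ℂ) (m : ℕ) (f : MvPolynomial (Fin 2) ℂ)
    (hf : f ∈ homogeneousSubmodule (Fin 2) ℂ m) :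
    subst g f ∈ homogeneousSubmodule (Fin 2) ℂ m := by
  have h := IsHomogeneous.aeval (n := 1) hf (fun j => ∑ i, C (g i j) * X i)
    (fun j => IsHomogeneous.sum _ _ _ fun i _ => isHomogeneous_C_mul_X _ _)
  simpa [subst] using h

theorem subst_one : subst 1 = AlgHom.id ℂ (MvPolynomial (Fin 2) ℂ) := by
  ext j : 1
  fin_cases j <;> simp [subst]

theorem subst_mul (g h : Matrix (Fin 2) (Fin 2) ℂ) :
    subst (g * h) = (subst g).comp (subst h) := by
  ext j : 1
  simp only [subst, aeval_X, AlgHom.comp_apply, Matrix.mul_apply, Fin.sum_univ_two, map_add,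
    map_mul, algHom_C, algebraMap_eq]
  ring

/-- The representation `ρ_m` of `SU(2)` on `P_m`, `(ρ_m(g) f)(x) = f(x g)`. -/
def rho (m : ℕ) : Representation ℂ SU2 (P m) where
  toFun g := (subst (g : Matrix (Fin 2) (Fin 2) ℂ)).toLinearMap.restrict (subst_mem _ m)
  map_one' := by
    ext1 f; apply Subtype.ext
    simp [LinearMap.restrict_apply, subst_one]
  map_mul' g h := by
    ext1 f; apply Subtype.ext
    simp only [Submonoid.coe_mul, subst_mul, Module.End.mul_apply, LinearMap.coe_restrict_apply]
    rfl

/-! ### The isometries `α_{m,n,h}` and the EPOSIC channels -/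

/-- Polynomials in `x₁, x₂, y₁, y₂`; `x₁, x₂ = X (inl 0), X (inl 1)` and
`y₁, y₂ = X (inr 0), X (inr 1)`. -/
abbrev PolyXY : Type := MvPolynomial (Fin 2 ⊕ Fin 2) ℂ

/-- The embedding `P_m(x) ⊗ P_n(y) → ℂ[x, y]`, `f(x) ⊗ g(y) ↦ f(x) g(y)`. -/
def tensorToPoly (m n : ℕ) : P m ⊗[ℂ] P n →ₗ[ℂ] PolyXY :=
  TensorProduct.lift ((LinearMap.mul ℂ PolyXY).compl₁₂
    ((rename Sum.inl).toLinearMap ∘ₗ (homogeneousSubmodule (Fin 2) ℂ m).subtype)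
    ((rename Sum.inr).toLinearMap ∘ₗ (homogeneousSubmodule (Fin 2) ℂ n).subtype))

/-- The exponent vector of `x₁^s x₂^(m-s) y₁^t y₂^(n-t)`. -/
def expoXY (m n : ℕ) (s : Fin (m + 1)) (t : Fin (n + 1)) : Fin 2 ⊕ Fin 2 →₀ ℕ :=
  Finsupp.sumElim (expo s (m - s)) (expo t (n - t))

/-- The identification of polynomials of bidegree `(m, n)` with `P_m ⊗ P_n` (the inverse of
`tensorToPoly`), sending `x₁^s x₂^(m-s) y₁^t y₂^(n-t)` to `x₁^s x₂^(m-s) ⊗ y₁^t y₂^(n-t)`. -/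
def polyToTensor (m n : ℕ) : PolyXY →ₗ[ℂ] P m ⊗[ℂ] P n :=
  ∑ s : Fin (m + 1), ∑ t : Fin (n + 1),
    (lcoeff ℂ (expoXY m n s t)).smulRight (mono m s ⊗ₜ[ℂ] mono n t)

theorem coef_mono (m : ℕ) (l k : Fin (m + 1)) : coef m l (mono m k) = if l = k then 1 else 0 := by
  have h : expo k (m - k) = expo l (m - l) ↔ l = k := by
    constructor
    · intro h
      have := DFunLike.congr_fun h 0
      simp [expo] at this
      exact Fin.ext this.symm
    · rintro rfl; rfl
  simp [coef, mono, coeff_monomial, h]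

theorem inner_mono (m : ℕ) (l k : Fin (m + 1)) :
    inner ℂ (mono m l) (mono m k) =
      if l = k then ((l : ℕ).factorial * (m - l).factorial : ℂ) else 0 := by
  change ∑ i : Fin (m + 1), _ = _
  by_cases h : l = k
  · subst h; simp [coef_mono]
  · simp [coef_mono, h, Ne.symm h]

theorem sum_coef_mono (m : ℕ) (f : P m) : ∑ l, coef m l f • mono m l = f := by
  rw [← sub_eq_zero]
  apply eq_zero_of_coef
  intro l
  simp [coef_mono]

theorem polyToTensor_tensorToPoly (m n : ℕ) (z : P m ⊗[ℂ] P n) :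
    polyToTensor m n (tensorToPoly m n z) = z := by
  have key : ∀ s t, polyToTensor m n (tensorToPoly m n (mono m s ⊗ₜ mono n t)) =
      mono m s ⊗ₜ mono n t := by
    intro s t
    have h1 : tensorToPoly m n (mono m s ⊗ₜ mono n t) = monomial (expoXY m n s t) 1 := by
      simp only [tensorToPoly, TensorProduct.lift.tmul, LinearMap.compl₁₂_apply,
        LinearMap.comp_apply, Submodule.subtype_apply, mono, AlgHom.toLinearMap_apply,
        rename_monomial, LinearMap.mul_apply', monomial_mul, mul_one]
      congr 2
      ext (i | i)
      · simp [expoXY, Finsupp.mapDomain_apply Sum.inl_injective,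
          Finsupp.mapDomain_of_notMem_range]
      · simp [expoXY, Finsupp.mapDomain_apply Sum.inr_injective,
          Finsupp.mapDomain_of_notMem_range]
    have h2 : ∀ s' t', expoXY m n s t = expoXY m n s' t' ↔ s = s' ∧ t = t' := by
      intro s' t'
      constructor
      · intro h
        have e1 := DFunLike.congr_fun h (Sum.inl 0)
        have e2 := DFunLike.congr_fun h (Sum.inr 0)
        simp [expoXY, expo] at e1 e2
        exact ⟨Fin.ext e1, Fin.ext e2⟩
      · rintro ⟨rfl, rfl⟩; rfl
    rw [h1]
    simp only [polyToTensor, LinearMap.sum_apply, LinearMap.smulRight_apply, lcoeff_apply,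
      coeff_monomial, h2, ite_smul, one_smul, zero_smul]
    rw [Finset.sum_eq_single s, Finset.sum_eq_single t] <;> simp +contextual [eq_comm]
  induction z with
  | zero => simp
  | add a b ha hb => rw [map_add, map_add, ha, hb]
  | tmul f g =>
    rw [← sum_coef_mono m f, ← sum_coef_mono n g]
    simp only [TensorProduct.sum_tmul, TensorProduct.tmul_sum, ← TensorProduct.smul_tmul',
      TensorProduct.tmul_smul, map_sum, map_smul, key]

/-- `Δ_yx = y₁ ∂/∂x₁ + y₂ ∂/∂x₂`. -/
def DeltaYX : PolyXY →ₗ[ℂ] PolyXY :=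
  LinearMap.mulLeft ℂ (X (Sum.inr 0)) ∘ₗ (pderiv (Sum.inl 0)).toLinearMap +
    LinearMap.mulLeft ℂ (X (Sum.inr 1)) ∘ₗ (pderiv (Sum.inl 1)).toLinearMap

/-- `Γ_xy`: multiplication by `x₁ y₂ - y₁ x₂`. -/
def GammaXY : PolyXY →ₗ[ℂ] PolyXY :=
  LinearMap.mulLeft ℂ
    (X (Sum.inl 0) * X (Sum.inr 1) - X (Sum.inr 0) * X (Sum.inl 1))

/-- The Clebsch-Gordan coefficients `c_{m,n,h}`, `0 ≤ h ≤ min m n`: `c_{m,0,0} = 1` and, for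
`n ≥ 1`, `(m+1) n c_{m,n,h}` is `c_{m+1,n-1,0}` if `h = 0`,
`c_{m-1,n-1,h-1} + c_{m+1,n-1,h}` if `0 < h < n`, and `c_{m-1,n-1,h-1}` if `h = n`. -/
def cgCoeff : ℕ → ℕ → ℕ → ℝ
  | _, 0, _ => 1
  | m, n + 1, 0 => cgCoeff (m + 1) n 0 / ((m + 1) * (n + 1))
  | m, n + 1, h + 1 =>
      (cgCoeff (m - 1) n h + if h + 1 < n + 1 then cgCoeff (m + 1) n (h + 1) else 0) /
        ((m + 1) * (n + 1))

/-- The map `α_{m,n,h} : P_r → P_m ⊗ P_n`, `f ↦ √c_{m,n,h} Γ_xy^h Δ_yx^(n-h) f(x)`,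
for `0 ≤ h ≤ min m n` and `r = m + n - 2h`. -/
def alpha (r m n h : ℕ) : P r →ₗ[ℂ] P m ⊗[ℂ] P n :=
  (Real.sqrt (cgCoeff m n h) : ℂ) •
    (polyToTensor m n ∘ₗ (GammaXY ^ h) ∘ₗ (DeltaYX ^ (n - h)) ∘ₗ
      (rename Sum.inl).toLinearMap ∘ₗ (homogeneousSubmodule (Fin 2) ℂ r).subtype)

/-- `Φ_{m,n,h} : End(P_r) → End(P_m)`, `Φ_{m,n,h}(A) = Tr_{P_n}(α_{m,n,h} A α_{m,n,h}^*)`,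
for `0 ≤ h ≤ min m n` and `r = m + n - 2h`. -/
def eposicMap (r m n h : ℕ) : Module.End ℂ (P r) →ₗ[ℂ] Module.End ℂ (P m) :=
  partialTrace (P m) (P n) ∘ₗ
    LinearMap.lcomp ℂ (P m ⊗[ℂ] P n) (LinearMap.adjoint (alpha r m n h)) ∘ₗ
    LinearMap.llcomp ℂ (P r) (P r) (P m ⊗[ℂ] P n) (alpha r m n h)

theorem eposicMap_apply (r m n h : ℕ) (A : Module.End ℂ (P r)) :
    eposicMap r m n h A = partialTrace (P m) (P n)
      (alpha r m n h ∘ₗ A ∘ₗ LinearMap.adjoint (alpha r m n h)) := rfl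

/-- `EC(r, m)`: the set of EPOSIC channels `End(P_r) → End(P_m)`, i.e. of the `Φ_{m,n,h}` with
`r = m + n - 2h` and `0 ≤ h ≤ min m n`. -/
def EC (r m : ℕ) : Set (Module.End ℂ (P r) →ₗ[ℂ] Module.End ℂ (P m)) :=
  {Φ | ∃ n h : ℕ, h ≤ min m n ∧ r = m + n - 2 * h ∧ Φ = eposicMap r m n h}

end

end EPOSIC

/-! Attach to a linear map `Φ` from `End(P_r)` to `End(P_m)` its Choi form, a sesquilinear form on
`Hom(P_m, P_r)`. It determines `Φ`, is nonnegative on the diagonal when `Φ` is completely positive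
(`choiForm_nonneg`), and is invariant under `S ↦ ρ_r(g) S ρ_m(g)^*` when `Φ` is covariant
(`choiForm_covariant`). As an `SU(2)`-module, `Hom(P_m, P_r)` is the multiplicity-free sum of the
`P_{r+m-2l}` for `0 ≤ l ≤ min r m`. By Schur's lemma an invariant form is therefore block diagonal
and a multiple of the inner product on each block, so a covariant map amounts to `min r m + 1`
numbers.

The blocks are realized by the Kraus operators `w ↦ α^*(w ⊗ y)`, where `α` is the `l`-th EPOSIC
isometry and `y` runs over `P_{r+m-2l}`. The map `A ↦ tr(A) 1` is covariant and its Choi form is the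
Hilbert–Schmidt inner product; Schur's lemma applied to it shows that the blocks are orthogonal, and
the count `sum_blockDim` shows that they fill the space. The Choi form of a Stinespring map is a sum
of rank one forms given by its Kraus operators (`choiForm_stinespring`), so that of the `l`-th
EPOSIC channel lives on block `l` alone and is positive there.

Normalizing the value of the Choi form at the highest weight vector of each block gives linear
coordinates dual to the EPOSIC channels. On channels they are nonnegative by complete positivity and
sum to one by trace preservation: they are barycentric coordinates, and the simplex statements
follow formally.

That the EPOSIC maps are channels rests on `α` being an isometry (`inner_alpha`). By Schur's lemma
this need only be checked on `x₁^r`, where it becomes a closed form for `cgCoeff` and a binomial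
convolution. -/

namespace EPOSIC

open MvPolynomial TensorProduct
open scoped ComplexOrder

noncomputable section

/-! ### Rank one operators and the Choi form. -/

section Choi

variable {H K E : Type*}
  [NormedAddCommGroup H] [InnerProductSpace ℂ H]
  [NormedAddCommGroup K] [InnerProductSpace ℂ K]
  [NormedAddCommGroup E] [InnerProductSpace ℂ E]

/-- The rank one operator `|x⟩⟨y|`. -/
def ketBra (x : H) (y : K) : K →ₗ[ℂ] H := (innerₛₗ ℂ y).smulRight x

theorem ketBra_apply (x : H) (y z : K) : ketBra x y z = inner ℂ y z • x := rfl

theorem ketBra_add_left (x x' : H) (y : K) : ketBra (x + x') y = ketBra x y + ketBra x' y := by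
  ext z; simp [ketBra_apply]

theorem ketBra_smul_left (c : ℂ) (x : H) (y : K) : ketBra (c • x) y = c • ketBra x y := by
  ext z; simp [ketBra_apply, smul_comm c]

theorem ketBra_add_right (x : H) (y y' : K) : ketBra x (y + y') = ketBra x y + ketBra x y' := by
  ext z; simp [ketBra_apply, add_smul]

theorem ketBra_smul_right (c : ℂ) (x : H) (y : K) :
    ketBra x (c • y) = starRingEnd ℂ c • ketBra x y := by
  ext z; simp [ketBra_apply, smul_smul, mul_comm]

theorem comp_ketBra (A : H →ₗ[ℂ] E) (x : H) (y : K) : A ∘ₗ ketBra x y = ketBra (A x) y := by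
  ext z; simp [ketBra_apply]

theorem sum_ketBra {ι : Type*} [Fintype ι] (f : OrthonormalBasis ι ℂ K) (S : K →ₗ[ℂ] H) :
    ∑ i, ketBra (S (f i)) (f i) = S := by
  ext z
  simp only [LinearMap.sum_apply, ketBra_apply, ← map_smul, ← map_sum]
  rw [f.sum_repr']

variable [FiniteDimensional ℂ K] [FiniteDimensional ℂ E]

theorem ketBra_comp_adjoint (A : K →ₗ[ℂ] E) (x : H) (y : K) :
    ketBra x y ∘ₗ LinearMap.adjoint A = ketBra x (A y) := by
  ext z; simp [ketBra_apply, LinearMap.adjoint_inner_right]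

theorem trace_ketBra [FiniteDimensional ℂ H] (x y : H) :
    LinearMap.trace ℂ H (ketBra x y) = inner ℂ y x := by
  rw [LinearMap.trace_eq_sum_inner _ (stdOrthonormalBasis ℂ H)]
  simp only [ketBra_apply, inner_smul_right]
  exact (stdOrthonormalBasis ℂ H).sum_inner_mul_inner y x

/-- The Choi form of a map `Φ : End(H) → End(K)`, a sesquilinear form on `Hom(K, H)`
characterized by `(|b⟩⟨a|, |d⟩⟨c|) ↦ ⟨a, Φ(|b⟩⟨d|) c⟩`. -/
def choiForm (Φ : Module.End ℂ H →ₗ[ℂ] Module.End ℂ K) :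
    (K →ₗ[ℂ] H) →ₗ[ℂ] (K →ₗ[ℂ] H) →ₗ⋆[ℂ] ℂ :=
  LinearMap.mk₂'ₛₗ (RingHom.id ℂ) (starRingEnd ℂ)
    (fun S T => ∑ i, ∑ j, inner ℂ (stdOrthonormalBasis ℂ K i)
      (Φ (ketBra (S (stdOrthonormalBasis ℂ K i)) (T (stdOrthonormalBasis ℂ K j)))
        (stdOrthonormalBasis ℂ K j)))
    (fun S S' T => by
      simp only [LinearMap.add_apply, ketBra_add_left, map_add, inner_add_right,
        Finset.sum_add_distrib])
    (fun c S T => by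
      simp only [LinearMap.smul_apply, ketBra_smul_left, map_smul, inner_smul_right,
        Finset.mul_sum, smul_eq_mul, RingHom.id_apply])
    (fun S T T' => by
      simp only [LinearMap.add_apply, ketBra_add_right, map_add, inner_add_right,
        Finset.sum_add_distrib])
    (fun c S T => by
      simp only [LinearMap.smul_apply, ketBra_smul_right, map_smul, inner_smul_right,
        Finset.mul_sum, smul_eq_mul])

theorem choiForm_apply (Φ : Module.End ℂ H →ₗ[ℂ] Module.End ℂ K) (S T : K →ₗ[ℂ] H) :
    choiForm Φ S T = ∑ i, ∑ j, inner ℂ (stdOrthonormalBasis ℂ K i)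
      (Φ (ketBra (S (stdOrthonormalBasis ℂ K i)) (T (stdOrthonormalBasis ℂ K j)))
        (stdOrthonormalBasis ℂ K j)) := rfl

theorem choiForm_add (Φ Ψ : Module.End ℂ H →ₗ[ℂ] Module.End ℂ K) (S T : K →ₗ[ℂ] H) :
    choiForm (Φ + Ψ) S T = choiForm Φ S T + choiForm Ψ S T := by
  simp only [choiForm_apply, LinearMap.add_apply, inner_add_right, Finset.sum_add_distrib]

theorem choiForm_smul (c : ℂ) (Φ : Module.End ℂ H →ₗ[ℂ] Module.End ℂ K) (S T : K →ₗ[ℂ] H) :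
    choiForm (c • Φ) S T = c * choiForm Φ S T := by
  simp only [choiForm_apply, LinearMap.smul_apply, inner_smul_right, Finset.mul_sum]

/-- Evaluation of the Choi form as a linear functional of the map. -/
def choiEval (S T : K →ₗ[ℂ] H) : (Module.End ℂ H →ₗ[ℂ] Module.End ℂ K) →ₗ[ℂ] ℂ where
  toFun Φ := choiForm Φ S T
  map_add' Φ Ψ := choiForm_add Φ Ψ S T
  map_smul' c Φ := choiForm_smul c Φ S T

theorem choiEval_apply (S T : K →ₗ[ℂ] H) (Φ : Module.End ℂ H →ₗ[ℂ] Module.End ℂ K) :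
    choiEval S T Φ = choiForm Φ S T := rfl

theorem choiForm_sub_sum {ι : Type*} [Fintype ι]
    (Φ : Module.End ℂ H →ₗ[ℂ] Module.End ℂ K) (c : ι → ℂ)
    (Ψ : ι → Module.End ℂ H →ₗ[ℂ] Module.End ℂ K) (S T : K →ₗ[ℂ] H) :
    choiForm (Φ - ∑ i, c i • Ψ i) S T = choiForm Φ S T - ∑ i, c i * choiForm (Ψ i) S T := by
  simp only [← choiEval_apply, map_sub, map_sum, map_smul, smul_eq_mul]

/-- Expanding `a` and `c` in the basis collapses both sums, so the form does not depend on the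
chosen basis. -/
theorem choiForm_ketBra (Φ : Module.End ℂ H →ₗ[ℂ] Module.End ℂ K) (a c : K) (b d : H) :
    choiForm Φ (ketBra b a) (ketBra d c) = inner ℂ a (Φ (ketBra b d) c) := by
  have h (i j) : inner ℂ (stdOrthonormalBasis ℂ K i)
      (Φ (ketBra (ketBra b a (stdOrthonormalBasis ℂ K i))
        (ketBra d c (stdOrthonormalBasis ℂ K j))) (stdOrthonormalBasis ℂ K j)) =
      inner ℂ a (stdOrthonormalBasis ℂ K i) * inner ℂ (stdOrthonormalBasis ℂ K i)
        (Φ (ketBra b d) (inner ℂ (stdOrthonormalBasis ℂ K j) c • stdOrthonormalBasis ℂ K j)) := by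
    simp only [ketBra_apply, ketBra_smul_left, ketBra_smul_right, map_smul, LinearMap.smul_apply,
      inner_smul_right, inner_conj_symm]
    ring
  simp only [choiForm_apply, h]
  simp only [← Finset.mul_sum, ← inner_sum, ← map_sum]
  rw [(stdOrthonormalBasis ℂ K).sum_repr', (stdOrthonormalBasis ℂ K).sum_inner_mul_inner]

/-- Rank one operators span `End(H)`, and on them the form gives every matrix coefficient of `Φ`. -/
theorem eq_zero_of_choiForm [FiniteDimensional ℂ H] (Φ : Module.End ℂ H →ₗ[ℂ] Module.End ℂ K)
    (h : ∀ S T, choiForm Φ S T = 0) : Φ = 0 := by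
  ext A c
  rw [← sum_ketBra (stdOrthonormalBasis ℂ H) A]
  rw [map_sum, LinearMap.sum_apply]
  refine Finset.sum_eq_zero fun i _ => ?_
  refine ext_inner_left ℂ fun a => ?_
  rw [← choiForm_ketBra, h]; simp

theorem choiForm_nonneg {Φ : Module.End ℂ H →ₗ[ℂ] Module.End ℂ K} (hΦ : IsCompletelyPositive Φ)
    (S : K →ₗ[ℂ] H) : 0 ≤ choiForm Φ S S := by
  -- With `u = (S e_i)_i`, this block operator is `|u⟩⟨u|`, hence positive; the vector left to
  -- unification is the basis `(e_i)` itself.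
  refine hΦ _ (fun i j => ketBra (S (stdOrthonormalBasis ℂ K i)) (S (stdOrthonormalBasis ℂ K j)))
    (fun v => ?_) _
  have : ∑ i, ∑ j, inner ℂ (v i) (ketBra (S (stdOrthonormalBasis ℂ K i))
      (S (stdOrthonormalBasis ℂ K j)) (v j)) =
      (∑ i, inner ℂ (v i) (S (stdOrthonormalBasis ℂ K i))) *
        starRingEnd ℂ (∑ i, inner ℂ (v i) (S (stdOrthonormalBasis ℂ K i))) := by
    rw [map_sum, Finset.sum_mul_sum]
    simp only [ketBra_apply, inner_smul_right, inner_conj_symm]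
    exact Finset.sum_congr rfl fun i _ => Finset.sum_congr rfl fun j _ => mul_comm _ _
  rw [this, Complex.mul_conj]
  exact_mod_cast Complex.normSq_nonneg _

/-- The completely depolarizing map `A ↦ tr(A) 1`. -/
def depolarizing (H K : Type*) [NormedAddCommGroup H] [InnerProductSpace ℂ H]
    [NormedAddCommGroup K] [InnerProductSpace ℂ K] : Module.End ℂ H →ₗ[ℂ] Module.End ℂ K :=
  (LinearMap.trace ℂ H).smulRight 1

/-- This is the Hilbert–Schmidt inner product of `T` and `S`. Having it as the Choi form of a
covariant map lets results on covariant maps yield orthogonality of Kraus operators. -/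
theorem choiForm_depolarizing [FiniteDimensional ℂ H] (S T : K →ₗ[ℂ] H) :
    choiForm (depolarizing H K) S T =
      ∑ i, inner ℂ (T (stdOrthonormalBasis ℂ K i)) (S (stdOrthonormalBasis ℂ K i)) := by
  simp only [choiForm_apply, depolarizing, LinearMap.smulRight_apply, trace_ketBra,
    LinearMap.smul_apply, Module.End.one_apply, inner_smul_right, OrthonormalBasis.inner_eq_ite]
  simp

theorem choiForm_depolarizing_self_pos [FiniteDimensional ℂ H] {S : K →ₗ[ℂ] H} (hS : S ≠ 0) :
    0 < choiForm (depolarizing H K) S S := by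
  rw [choiForm_depolarizing]
  have h1 : ∀ i, inner ℂ (S (stdOrthonormalBasis ℂ K i)) (S (stdOrthonormalBasis ℂ K i)) =
      ((‖S (stdOrthonormalBasis ℂ K i)‖ ^ 2 : ℝ) : ℂ) := fun i => by
    rw [inner_self_eq_norm_sq_to_K]; norm_cast
  simp only [h1, ← Complex.ofReal_sum]
  rw [Complex.zero_lt_real]
  refine lt_of_le_of_ne (Finset.sum_nonneg fun i _ => sq_nonneg _) fun h => hS ?_
  rw [eq_comm, Finset.sum_eq_zero_iff_of_nonneg fun i _ => sq_nonneg _] at h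
  refine (stdOrthonormalBasis ℂ K).toBasis.ext fun i => ?_
  simpa using h i (Finset.mem_univ _)

end Choi

/-! ### Covariance, partial trace and Stinespring maps. -/

section Unitary

variable {G H K E : Type*} [Group G]
  [NormedAddCommGroup H] [InnerProductSpace ℂ H] [FiniteDimensional ℂ H]
  [NormedAddCommGroup K] [InnerProductSpace ℂ K] [FiniteDimensional ℂ K]
  [NormedAddCommGroup E] [InnerProductSpace ℂ E] [FiniteDimensional ℂ E]

/-- A representation by unitary operators. -/
def IsUnitaryRep (π : Representation ℂ G H) : Prop :=
  ∀ g x y, inner ℂ (π g x) (π g y) = inner ℂ x y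

theorem IsUnitaryRep.adjoint_eq {π : Representation ℂ G H} (h : IsUnitaryRep π) (g : G) :
    LinearMap.adjoint (π g) = π g⁻¹ := by
  refine LinearMap.ext fun x => ext_inner_left ℂ fun v => ?_
  rw [LinearMap.adjoint_inner_right, ← h g v, π.self_inv_apply]

/-- Covariance of a linear map `End(H) → End(K)`. -/
def IsCovariant (πH : Representation ℂ G H) (πK : Representation ℂ G K)
    (Φ : Module.End ℂ H →ₗ[ℂ] Module.End ℂ K) : Prop :=
  ∀ (g : G) (A : Module.End ℂ H),
    Φ (πH g ∘ₗ A ∘ₗ LinearMap.adjoint (πH g)) = πK g ∘ₗ Φ A ∘ₗ LinearMap.adjoint (πK g)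

theorem choiForm_covariant {πH : Representation ℂ G H} {πK : Representation ℂ G K}
    (hK : IsUnitaryRep πK) {Φ : Module.End ℂ H →ₗ[ℂ] Module.End ℂ K}
    (hΦ : IsCovariant πH πK Φ) (g : G) (S T : K →ₗ[ℂ] H) :
    choiForm Φ (πH g ∘ₗ S ∘ₗ LinearMap.adjoint (πK g))
      (πH g ∘ₗ T ∘ₗ LinearMap.adjoint (πK g)) = choiForm Φ S T := by
  have hS (S : K →ₗ[ℂ] H) : πH g ∘ₗ S ∘ₗ LinearMap.adjoint (πK g) =
      ∑ i, ketBra (πH g (S (stdOrthonormalBasis ℂ K i))) (πK g (stdOrthonormalBasis ℂ K i)) := by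
    conv_lhs => rw [← sum_ketBra (stdOrthonormalBasis ℂ K) S]
    ext x
    simp [ketBra_apply, LinearMap.adjoint_inner_right]
  rw [hS S, hS T, choiForm_apply Φ S T]
  simp only [map_sum, LinearMap.sum_apply, choiForm_ketBra]
  rw [Finset.sum_comm]
  refine Finset.sum_congr rfl fun i _ => Finset.sum_congr rfl fun j _ => ?_
  -- The rotated rank one operator is a conjugate of the original one; covariance moves the
  -- conjugation outside `Φ`, where it cancels against the rotated basis vectors.
  rw [← comp_ketBra, ← ketBra_comp_adjoint, hΦ]
  simp only [LinearMap.comp_apply]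
  rw [hK, hK.adjoint_eq, πK.inv_self_apply]

theorem isCovariant_depolarizing {πH : Representation ℂ G H} {πK : Representation ℂ G K}
    (hH : IsUnitaryRep πH) (hK : IsUnitaryRep πK) :
    IsCovariant πH πK (depolarizing H K) := by
  intro g A
  have h1 : LinearMap.trace ℂ H (πH g ∘ₗ A ∘ₗ LinearMap.adjoint (πH g)) =
      LinearMap.trace ℂ H A := by
    rw [LinearMap.trace_comp_comm', hH.adjoint_eq, LinearMap.comp_assoc]
    congr 1
    ext x
    simp
  have h2 : πK g ∘ₗ LinearMap.adjoint (πK g) = 1 := by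
    rw [hK.adjoint_eq]; ext x; simp
  simp only [depolarizing, LinearMap.smulRight_apply, h1, LinearMap.smul_comp, LinearMap.comp_smul]
  rw [show (1 : Module.End ℂ K) ∘ₗ LinearMap.adjoint (πK g) = LinearMap.adjoint (πK g) from
    LinearMap.id_comp _, h2]

theorem inner_partialTrace {ι : Type*} [Fintype ι] (e : OrthonormalBasis ι ℂ E)
    (X : Module.End ℂ (K ⊗[ℂ] E)) (a b : K) :
    inner ℂ a (partialTrace K E X b) = ∑ t, inner ℂ (a ⊗ₜ[ℂ] e t) (X (b ⊗ₜ[ℂ] e t)) := by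
  obtain ⟨z, rfl⟩ := (homTensorHomEquiv ℂ K E K E).surjective X
  induction z with
  | zero => simp
  | add x y hx hy => simp only [map_add, LinearMap.add_apply, inner_add_right, hx, hy,
      Finset.sum_add_distrib]
  | tmul A B =>
    rw [homTensorHomEquiv_apply, homTensorHomMap_apply, partialTrace_map,
      LinearMap.trace_eq_sum_inner _ e]
    simp [mul_comm, Finset.mul_sum]

theorem trace_partialTrace (X : Module.End ℂ (K ⊗[ℂ] E)) :
    LinearMap.trace ℂ K (partialTrace K E X) = LinearMap.trace ℂ (K ⊗[ℂ] E) X := by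
  obtain ⟨z, rfl⟩ := (homTensorHomEquiv ℂ K E K E).surjective X
  induction z with
  | zero => simp
  | add x y hx hy => simp only [map_add, hx, hy]
  | tmul A B =>
    rw [homTensorHomEquiv_apply, homTensorHomMap_apply, partialTrace_map,
      LinearMap.trace_tensorProduct', map_smul, smul_eq_mul, mul_comm]

/-- The map `A ↦ Tr_E(α A α^*)` with Stinespring operator `α : H → K ⊗ E`. -/
def stinespring (α : H →ₗ[ℂ] K ⊗[ℂ] E) : Module.End ℂ H →ₗ[ℂ] Module.End ℂ K :=
  partialTrace K E ∘ₗ LinearMap.lcomp ℂ (K ⊗[ℂ] E) (LinearMap.adjoint α) ∘ₗ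
    LinearMap.llcomp ℂ H H (K ⊗[ℂ] E) α

theorem stinespring_apply (α : H →ₗ[ℂ] K ⊗[ℂ] E) (A : Module.End ℂ H) :
    stinespring α A = partialTrace K E (α ∘ₗ A ∘ₗ LinearMap.adjoint α) := rfl

/-- The adjoint Kraus operators `w ↦ α^*(w ⊗ y)` of `stinespring α`. -/
def kraus (α : H →ₗ[ℂ] K ⊗[ℂ] E) : E →ₗ[ℂ] K →ₗ[ℂ] H :=
  LinearMap.compr₂ (TensorProduct.mk ℂ K E).flip (LinearMap.adjoint α)

theorem kraus_apply (α : H →ₗ[ℂ] K ⊗[ℂ] E) (y : E) (w : K) :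
    kraus α y w = LinearMap.adjoint α (w ⊗ₜ y) := rfl

theorem inner_stinespring {ι : Type*} [Fintype ι] (e : OrthonormalBasis ι ℂ E)
    (α : H →ₗ[ℂ] K ⊗[ℂ] E) (A : Module.End ℂ H) (a b : K) :
    inner ℂ a (stinespring α A b) = ∑ t, inner ℂ (kraus α (e t) a) (A (kraus α (e t) b)) := by
  rw [stinespring_apply, inner_partialTrace e]
  simp only [LinearMap.comp_apply, kraus_apply, LinearMap.adjoint_inner_left]

theorem isCompletelyPositive_stinespring (α : H →ₗ[ℂ] K ⊗[ℂ] E) :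
    IsCompletelyPositive (stinespring α) := by
  intro k A hA w
  simp only [inner_stinespring (stdOrthonormalBasis ℂ E)]
  rw [Finset.sum_congr rfl fun i _ => Finset.sum_comm, Finset.sum_comm]
  exact Finset.sum_nonneg fun t _ => hA fun i => kraus α (stdOrthonormalBasis ℂ E t) (w i)

theorem isQuantumChannel_stinespring {α : H →ₗ[ℂ] K ⊗[ℂ] E}
    (hα : ∀ x y, inner ℂ (α x) (α y) = inner ℂ x y) : IsQuantumChannel (stinespring α) := by
  refine ⟨isCompletelyPositive_stinespring α, fun A => ?_⟩
  have h : LinearMap.adjoint α ∘ₗ α = LinearMap.id := by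
    refine LinearMap.ext fun x => ext_inner_left ℂ fun v => ?_
    rw [LinearMap.comp_apply, LinearMap.adjoint_inner_right, hα, LinearMap.id_apply]
  rw [stinespring_apply, trace_partialTrace, LinearMap.trace_comp_comm', LinearMap.comp_assoc, h,
    LinearMap.comp_id]

/-- Each Kraus operator contributes the rank one form `(S, T) ↦ ⟨k, S⟩ ⟨T, k⟩` in the
Hilbert–Schmidt product. -/
theorem choiForm_stinespring {ι : Type*} [Fintype ι] (e : OrthonormalBasis ι ℂ E)
    (α : H →ₗ[ℂ] K ⊗[ℂ] E) (S T : K →ₗ[ℂ] H) :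
    choiForm (stinespring α) S T = ∑ t, choiForm (depolarizing H K) S (kraus α (e t)) *
      choiForm (depolarizing H K) (kraus α (e t)) T := by
  simp only [choiForm_apply (stinespring α), inner_stinespring e, ketBra_apply, inner_smul_right,
    choiForm_depolarizing, Finset.sum_mul_sum]
  rw [Finset.sum_congr rfl fun i _ => Finset.sum_comm, Finset.sum_comm]
  exact Finset.sum_congr rfl fun t _ => Finset.sum_congr rfl fun i _ =>
    Finset.sum_congr rfl fun j _ => mul_comm _ _

/-- `α : H → K ⊗ E` intertwines `πH` and `πK ⊗ πE`. -/
def IsTensorIntertwiner (πH : Representation ℂ G H) (πK : Representation ℂ G K)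
    (πE : Representation ℂ G E) (α : H →ₗ[ℂ] K ⊗[ℂ] E) : Prop :=
  ∀ g x, α (πH g x) = TensorProduct.map (πK g) (πE g) (α x)

variable {πH : Representation ℂ G H} {πK : Representation ℂ G K} {πE : Representation ℂ G E}

/-- Taking adjoints in the intertwining relation at `g⁻¹` shows that the Kraus operators span an
equivariant image of `E` inside `Hom(K, H)`. -/
theorem kraus_intertwiner (hH : IsUnitaryRep πH) (hK : IsUnitaryRep πK) (hE : IsUnitaryRep πE)
    {α : H →ₗ[ℂ] K ⊗[ℂ] E} (hα : IsTensorIntertwiner πH πK πE α) (g : G) (y : E) :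
    kraus α (πE g y) = πH g ∘ₗ kraus α y ∘ₗ LinearMap.adjoint (πK g) := by
  have h1 : LinearMap.adjoint (α ∘ₗ πH g⁻¹) =
      LinearMap.adjoint (TensorProduct.map (πK g⁻¹) (πE g⁻¹) ∘ₗ α) :=
    congrArg _ (LinearMap.ext (hα g⁻¹))
  rw [LinearMap.adjoint_comp, LinearMap.adjoint_comp, TensorProduct.adjoint_map, hH.adjoint_eq,
    hK.adjoint_eq, hE.adjoint_eq, inv_inv] at h1
  ext w
  have h2 := LinearMap.congr_fun h1 (πK g⁻¹ w ⊗ₜ y)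
  simp only [LinearMap.comp_apply, TensorProduct.map_tmul, πK.self_inv_apply] at h2
  simp only [LinearMap.comp_apply, kraus_apply, hK.adjoint_eq, h2]

theorem isCovariant_stinespring
    (hE : IsUnitaryRep πE) {α : H →ₗ[ℂ] K ⊗[ℂ] E} (hα : IsTensorIntertwiner πH πK πE α) :
    IsCovariant πH πK (stinespring α) := by
  intro g A
  have h1 : LinearMap.adjoint (α ∘ₗ πH g) =
      LinearMap.adjoint (TensorProduct.map (πK g) (πE g) ∘ₗ α) :=
    congrArg _ (LinearMap.ext (hα g))
  have h2 : ∀ X, partialTrace K E (TensorProduct.map (πK g) (πE g) ∘ₗ X ∘ₗ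
      LinearMap.adjoint (TensorProduct.map (πK g) (πE g))) =
      πK g ∘ₗ partialTrace K E X ∘ₗ LinearMap.adjoint (πK g) := by
    intro X
    rw [TensorProduct.adjoint_map]
    obtain ⟨z, rfl⟩ := (homTensorHomEquiv ℂ K E K E).surjective X
    induction z with
    | zero => simp
    | add x y hx hy => simp only [map_add, LinearMap.comp_add, LinearMap.add_comp, hx, hy]
    | tmul A B =>
      rw [homTensorHomEquiv_apply, homTensorHomMap_apply, partialTrace_map, ← map_comp, ← map_comp,
        partialTrace_map, LinearMap.trace_comp_comm', LinearMap.comp_assoc, hE.adjoint_eq]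
      have : πE g⁻¹ ∘ₗ πE g = LinearMap.id := by ext; simp
      rw [this, LinearMap.comp_id, LinearMap.smul_comp, LinearMap.comp_smul]
  rw [stinespring_apply, stinespring_apply, ← h2]
  rw [LinearMap.adjoint_comp, LinearMap.adjoint_comp] at h1
  simp only [LinearMap.comp_assoc, h1]
  simp only [← LinearMap.comp_assoc]
  rw [show α ∘ₗ πH g = TensorProduct.map (πK g) (πE g) ∘ₗ α from LinearMap.ext (hα g)]

end Unitary

/-! ### Unitarity of `ρ_m`, highest weight vectors and Schur's lemma. -/

section Representations

theorem monomial_expo (i j : ℕ) (c : ℂ) :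
    (monomial (expo i j) c : MvPolynomial (Fin 2) ℂ) = C c * (X 0 ^ i * X 1 ^ j) := by
  rw [X_pow_eq_monomial, X_pow_eq_monomial, monomial_mul, C_mul_monomial, expo]
  simp

theorem mono_coe (m : ℕ) (l : Fin (m + 1)) :
    (mono m l : MvPolynomial (Fin 2) ℂ) = X 0 ^ (l : ℕ) * X 1 ^ (m - l : ℕ) := by
  change monomial (expo l (m - l)) (1 : ℂ) = _
  rw [monomial_expo]; simp

theorem rho_coe (m : ℕ) (g : SU2) (f : P m) :
    (rho m g f : MvPolynomial (Fin 2) ℂ) = subst (g : Matrix (Fin 2) (Fin 2) ℂ) f := rfl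

/-- The highest weight vector `x₁ ^ m` of `P_m`. -/
def top (m : ℕ) : P m := mono m (Fin.last m)

theorem top_coe (m : ℕ) : (top m : MvPolynomial (Fin 2) ℂ) = X 0 ^ m := by
  simp [top, mono_coe]

theorem rho_top (m : ℕ) (g : SU2) :
    rho m g (top m) = ∑ l : Fin (m + 1),
      (m.choose l * (g.1 0 0 ^ (l : ℕ) * g.1 1 0 ^ (m - l : ℕ)) : ℂ) • mono m l := by
  apply Subtype.ext
  rw [rho_coe, top_coe, map_pow, subst, aeval_X, Fin.sum_univ_two, add_pow,
    AddSubmonoidClass.coe_finsetSum, ← Fin.sum_univ_eq_sum_range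
      (fun k => (C (g.1 0 0) * X 0) ^ k * (C (g.1 1 0) * X 1) ^ (m - k) *
        ((m.choose k : ℕ) : MvPolynomial (Fin 2) ℂ))]
  refine Finset.sum_congr rfl fun l _ => ?_
  rw [SetLike.val_smul, mono_coe, smul_eq_C_mul]
  simp only [map_mul, map_pow, map_natCast]
  ring

theorem eval_rho (m : ℕ) (g : SU2) (f : P m) (c : Fin 2 → ℂ) :
    eval c (rho m g f : MvPolynomial (Fin 2) ℂ) =
      eval (fun j => ∑ i, g.1 i j * c i) (f : MvPolynomial (Fin 2) ℂ) := by
  have h : (aeval c).comp (subst g.1) = aeval (R := ℂ) (fun j => ∑ i, g.1 i j * c i) := by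
    ext j
    simp [subst]
  simpa [rho_coe, coe_aeval_eq_eval] using AlgHom.congr_fun h (f : MvPolynomial (Fin 2) ℂ)

/-- The rotated highest weight vectors act as a reproducing kernel: the factorial weights of the
inner product cancel the binomial coefficients of `rho_top` up to `m!`. -/
theorem inner_rho_top (m : ℕ) (g : SU2) (f : P m) :
    inner ℂ (rho m g (top m)) f =
      m.factorial * eval (fun i => starRingEnd ℂ (g.1 i 0)) (f : MvPolynomial (Fin 2) ℂ) := by
  conv_lhs => rw [← sum_coef_mono m f]
  conv_rhs => rw [← sum_coef_mono m f]
  rw [rho_top]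
  simp only [sum_inner, inner_sum, inner_smul_left, inner_smul_right, inner_mono, mul_ite, mul_zero,
    AddSubmonoidClass.coe_finsetSum, SetLike.val_smul, map_sum, Finset.mul_sum, mono_coe,
    smul_eval, map_mul, map_pow, eval_X, map_natCast, Finset.mem_univ, if_true,
    Finset.sum_ite_eq']
  refine Finset.sum_congr rfl fun l _ => ?_
  have h : (m.factorial : ℂ) = m.choose l * (l : ℕ).factorial * (m - l).factorial := by
    exact_mod_cast (Nat.choose_mul_factorial_mul_factorial (Nat.lt_succ_iff.mp l.2)).symm
  rw [h]; ring

/-- The rotation matrix with first column proportional to `(1, t)`. -/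
def rotation (t : ℝ) : SU2 :=
  ⟨!![((√(1 + t ^ 2))⁻¹ : ℝ), ((-t * (√(1 + t ^ 2))⁻¹ : ℝ) : ℂ);
    ((t * (√(1 + t ^ 2))⁻¹ : ℝ) : ℂ), ((√(1 + t ^ 2))⁻¹ : ℝ)], by
    have h : (√(1 + t ^ 2))⁻¹ * (√(1 + t ^ 2))⁻¹ * (1 + t ^ 2) = 1 := by
      have h1 := Real.mul_self_sqrt (show 0 ≤ 1 + t ^ 2 by positivity)
      have h2 : √(1 + t ^ 2) ≠ 0 := by positivity
      field_simp
      nlinarith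
    have h' : ((√(1 + t ^ 2))⁻¹ : ℂ) * (√(1 + t ^ 2) : ℂ)⁻¹ * (1 + t ^ 2) = 1 := by
      exact_mod_cast h
    rw [Matrix.mem_specialUnitaryGroup_iff, Matrix.mem_unitaryGroup_iff]
    constructor
    · ext i j
      fin_cases i <;> fin_cases j <;>
        simp [Matrix.mul_apply, Fin.sum_univ_two, Matrix.star_apply, Complex.conj_ofReal] <;>
        first | linear_combination h' | ring
    · rw [Matrix.det_fin_two_of]
      push_cast
      linear_combination h'⟩

/-- The diagonal matrix `diag(exp(iθ), exp(-iθ))`. -/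
def torus (θ : ℝ) : SU2 :=
  ⟨!![Complex.exp (θ * Complex.I), 0; 0, Complex.exp (-(θ * Complex.I))], by
    have h : starRingEnd ℂ (Complex.exp (θ * Complex.I)) = Complex.exp (-(θ * Complex.I)) := by
      rw [← Complex.exp_conj]; simp
    have h' : starRingEnd ℂ (Complex.exp (-(θ * Complex.I))) = Complex.exp (θ * Complex.I) := by
      rw [← Complex.exp_conj]; simp
    rw [Matrix.mem_specialUnitaryGroup_iff, Matrix.mem_unitaryGroup_iff]
    constructor
    · ext i j
      fin_cases i <;> fin_cases j <;>
        simp [Matrix.mul_apply, Fin.sum_univ_two, Matrix.star_apply, h, h', ← Complex.exp_add]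
    · rw [Matrix.det_fin_two_of]
      simp [← Complex.exp_add]⟩

theorem rho_torus (m : ℕ) (θ : ℝ) (l : Fin (m + 1)) :
    rho m (torus θ) (mono m l) =
      Complex.exp ((2 * (l : ℕ) - m : ℤ) * (θ * Complex.I)) • mono m l := by
  apply Subtype.ext
  rw [rho_coe, SetLike.val_smul, mono_coe, map_mul, map_pow, map_pow, subst, aeval_X, aeval_X,
    Fin.sum_univ_two, Fin.sum_univ_two, smul_eq_C_mul]
  have h : Complex.exp ((2 * (l : ℕ) - m : ℤ) * (θ * Complex.I)) =
      Complex.exp (θ * Complex.I) ^ (l : ℕ) * Complex.exp (-(θ * Complex.I)) ^ (m - l : ℕ) := by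
    rw [← Complex.exp_nat_mul, ← Complex.exp_nat_mul, ← Complex.exp_add]
    congr 1
    push_cast [Nat.lt_succ_iff.mp l.2]
    ring
  rw [h]
  simp only [torus, Matrix.of_apply, Matrix.cons_val', Matrix.cons_val_zero, Matrix.cons_val_one,
    Matrix.cons_val_fin_one, map_zero, map_mul, map_pow]
  ring

/-- Substitutes for irreducibility. On the vectors rotated by `rotation t`, a functional is, up to a
nonzero factor, a polynomial in `t` with coefficients `m.choose l * φ (mono m l)`. If it vanishes
for all real `t`, then `φ` kills every monomial. -/
theorem span_rho_top (m : ℕ) : Submodule.span ℂ (Set.range fun g => rho m g (top m)) = ⊤ := by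
  by_contra hne
  obtain ⟨φ, hφ, hle⟩ := Submodule.exists_le_ker_of_lt_top _ (lt_top_iff_ne_top.mpr hne)
  apply hφ
  have h0 : ∀ g, φ (rho m g (top m)) = 0 := fun g =>
    LinearMap.mem_ker.mp (hle (Submodule.subset_span ⟨g, rfl⟩))
  let p : Polynomial ℂ := ∑ l : Fin (m + 1),
    Polynomial.monomial (m - l : ℕ) (m.choose l * φ (mono m l) : ℂ)
  have hp : p = 0 := by
    apply Polynomial.eq_zero_of_infinite_isRoot
    refine Set.Infinite.mono ?_ (Set.infinite_range_of_injective Complex.ofReal_injective)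
    rintro _ ⟨t, rfl⟩
    have h1 := h0 (rotation t)
    have hs : ((√(1 + t ^ 2))⁻¹ : ℂ) ≠ 0 := by
      have : √(1 + t ^ 2) ≠ 0 := by positivity
      exact_mod_cast inv_ne_zero this
    rw [rho_top, map_sum] at h1
    rw [Set.mem_ofPred_eq, Polynomial.IsRoot, Polynomial.eval_finsetSum]
    have h2 : ((√(1 + t ^ 2))⁻¹ : ℂ) ^ m * ∑ l : Fin (m + 1), Polynomial.eval (t : ℂ)
        (Polynomial.monomial (m - l : ℕ) (m.choose l * φ (mono m l) : ℂ)) = 0 := by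
      rw [← h1, Finset.mul_sum]
      refine Finset.sum_congr rfl fun l _ => ?_
      have h3 : ((√(1 + t ^ 2))⁻¹ : ℂ) ^ m =
          (√(1 + t ^ 2) : ℂ)⁻¹ ^ (l : ℕ) * (√(1 + t ^ 2) : ℂ)⁻¹ ^ (m - l : ℕ) := by
        rw [← pow_add]; congr 1; omega
      rw [Polynomial.eval_monomial, map_smul, h3]
      simp [rotation, mul_pow]
      ring
    exact (mul_eq_zero.mp h2).resolve_left (pow_ne_zero _ hs)
  ext f
  rw [← sum_coef_mono m f, map_sum, LinearMap.zero_apply]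
  refine Finset.sum_eq_zero fun l _ => ?_
  have h1 : p.coeff (m - l) = m.choose l * φ (mono m l) := by
    simp only [p, Polynomial.finsetSum_coeff, Polynomial.coeff_monomial]
    rw [Finset.sum_eq_single l]
    · simp
    · intro k _ hk
      rw [if_neg]
      have : (k : ℕ) ≠ l := fun h => hk (Fin.ext h)
      omega
    · simp
  rw [hp, Polynomial.coeff_zero, eq_comm, mul_eq_zero] at h1
  have h2 : (m.choose l : ℂ) ≠ 0 := by
    exact_mod_cast (Nat.choose_pos (Nat.lt_succ_iff.mp l.2)).ne'
  rw [map_smul, h1.resolve_left h2, smul_zero]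

/-- The left vector may be taken in the orbit of `top m`, where both inner products are point
evaluations of `y`; the points agree because `g^* g = 1`. -/
theorem isUnitaryRep_rho (m : ℕ) : IsUnitaryRep (rho m) := by
  intro g x y
  have hx : x ∈ Submodule.span ℂ (Set.range fun g => rho m g (top m)) := by
    rw [span_rho_top]; trivial
  induction hx using Submodule.span_induction with
  | zero => simp
  | add a b _ _ ha hb => simp only [map_add, inner_add_left, ha, hb]
  | smul c a _ ha => simp only [map_smul, inner_smul_left, ha]
  | mem a ha =>
    obtain ⟨h, rfl⟩ := ha
    dsimp only
    rw [← Module.End.mul_apply, ← map_mul, inner_rho_top, inner_rho_top, eval_rho]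
    congr 3
    funext j
    have hu : star (g : Matrix (Fin 2) (Fin 2) ℂ) * g.1 = 1 :=
      (Matrix.mem_unitaryGroup_iff').mp (Matrix.mem_specialUnitaryGroup_iff.mp g.2).1
    have hk (k) := congrFun (congrFun hu k) j
    simp only [Matrix.mul_apply, Fin.sum_univ_two, Matrix.star_apply, RCLike.star_def] at hk
    simp only [map_mul, Fin.sum_univ_two, Submonoid.coe_mul, Matrix.mul_apply, map_add]
    have h0 := hk 0
    have h1 := hk 1
    fin_cases j <;> simp [Matrix.one_apply] at h0 h1 ⊢
    · linear_combination starRingEnd ℂ (h.1 0 0) * h0 + starRingEnd ℂ (h.1 1 0) * h1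
    · linear_combination starRingEnd ℂ (h.1 0 0) * h0 + starRingEnd ℂ (h.1 1 0) * h1

theorem finrank_P (m : ℕ) : Module.finrank ℂ (P m) = m + 1 := by
  have e : P m ≃ₗ[ℂ] (Fin (m + 1) → ℂ) := LinearEquiv.ofBijective (LinearMap.pi (coef m))
    ⟨by
      rw [← LinearMap.ker_eq_bot, LinearMap.ker_eq_bot']
      exact fun f hf => eq_zero_of_coef m f fun l => congrFun hf l,
    fun c => ⟨∑ l, c l • mono m l, by ext l; simp [coef_mono]⟩⟩
  rw [e.finrank_eq]; simp

theorem inner_top_top (m : ℕ) : inner ℂ (top m) (top m) = (m.factorial : ℂ) := by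
  rw [top, inner_mono]; simp

/-! ### Invariant sesquilinear forms. -/

variable {n n' : ℕ}

/-- Invariance of a sesquilinear form on `P_n × P_n'`. -/
def IsInvariantForm (B : P n →ₗ[ℂ] P n' →ₗ⋆[ℂ] ℂ) : Prop :=
  ∀ g x y, B (rho n g x) (rho n' g y) = B x y

theorem IsInvariantForm.mono_mono {B : P n →ₗ[ℂ] P n' →ₗ⋆[ℂ] ℂ} (hB : IsInvariantForm B)
    (a : Fin (n + 1)) (b : Fin (n' + 1)) (hab : (2 * a - n : ℤ) ≠ 2 * b - n') :
    B (mono n a) (mono n' b) = 0 := by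
  set k : ℤ := (2 * a - n) - (2 * b - n') with hk
  have hk0 : (k : ℂ) ≠ 0 := by
    have : k ≠ 0 := sub_ne_zero.mpr hab
    exact_mod_cast this
  -- The torus multiplies this value by `exp(ikθ)`, where `k` is the difference of weights; `θ =
  -- π/k` makes the factor `-1`.
  have h := hB (torus (Real.pi / k)) (mono n a) (mono n' b)
  rw [rho_torus, rho_torus, map_smulₛₗ, map_smulₛₗ, LinearMap.smul_apply, smul_eq_mul, smul_eq_mul,
    RingHom.id_apply, mul_left_comm,
    ← Complex.exp_conj, ← mul_assoc, ← Complex.exp_add] at h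
  have h1 : ((2 * (a : ℕ) - n : ℤ) : ℂ) * (((Real.pi / k : ℝ) : ℂ) * Complex.I) +
      starRingEnd ℂ (((2 * (b : ℕ) - n' : ℤ) : ℂ) * (((Real.pi / k : ℝ) : ℂ) * Complex.I)) =
      Real.pi * Complex.I := by
    simp only [map_mul, Complex.conj_ofReal, Complex.conj_I, map_intCast]
    have : (k : ℂ) = ((2 * (a : ℕ) - n : ℤ) : ℂ) - ((2 * (b : ℕ) - n' : ℤ) : ℂ) := by
      rw [hk]; push_cast; ring
    push_cast at this ⊢
    field_simp
    rw [this]; ring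
  rw [h1, Complex.exp_pi_mul_I] at h
  linear_combination (-1 / 2) * h

theorem IsInvariantForm.eq_zero_of_top_left {B : P n →ₗ[ℂ] P n' →ₗ⋆[ℂ] ℂ}
    (hB : IsInvariantForm B) (h : ∀ b, B (top n) (mono n' b) = 0) : B = 0 := by
  have h1 : B (top n) = 0 := by
    ext y
    rw [← sum_coef_mono n' y]
    simp [h]
  refine LinearMap.ext_on_range (span_rho_top n) fun g => ?_
  ext y
  rw [← (rho n').self_inv_apply g y, hB, h1]
  simp

/-- The highest weight of the larger space is not a weight of the smaller one, so its highest weight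
vector pairs to zero with everything, and so does its orbit, which spans. -/
theorem IsInvariantForm.eq_zero_of_ne {B : P n →ₗ[ℂ] P n' →ₗ⋆[ℂ] ℂ}
    (hB : IsInvariantForm B) (hn : n ≠ n') : B = 0 := by
  rcases lt_or_gt_of_ne hn with hlt | hlt
  · have h1 : ∀ x, B x (top n') = 0 := by
      intro x
      rw [← sum_coef_mono n x, map_sum, LinearMap.sum_apply]
      refine Finset.sum_eq_zero fun a _ => ?_
      rw [map_smul, LinearMap.smul_apply, top, hB.mono_mono, smul_zero]
      have := a.2
      simp only [Fin.val_last]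
      omega
    ext x y
    have hy : y ∈ Submodule.span ℂ (Set.range fun g => rho n' g (top n')) := by
      rw [span_rho_top]; trivial
    induction hy using Submodule.span_induction with
    | zero => simp
    | add a b _ _ ha hb => simp only [map_add, ha, hb]
    | smul c a _ ha => simp only [map_smulₛₗ, ha]
    | mem a ha =>
      obtain ⟨g, rfl⟩ := ha
      rw [← (rho n).self_inv_apply g x, hB, h1]
      simp
  · refine hB.eq_zero_of_top_left fun b => hB.mono_mono _ _ ?_
    have := b.2
    simp only [Fin.val_last]
    omega

/-- Schur's lemma for invariant sesquilinear forms on `P_n`. -/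
theorem IsInvariantForm.eq_smul_inner {B : P n →ₗ[ℂ] P n →ₗ⋆[ℂ] ℂ}
    (hB : IsInvariantForm B) (x y : P n) :
    B x y = B (top n) (top n) / n.factorial * inner ℂ y x := by
  have hn : (n.factorial : ℂ) ≠ 0 := by exact_mod_cast n.factorial_ne_zero
  -- The multiple is chosen so that `B'` vanishes at the pair of highest weight vectors, the only
  -- weight-compatible pair involving `top n` on the left.
  set B' : P n →ₗ[ℂ] P n →ₗ⋆[ℂ] ℂ :=
    B - (B (top n) (top n) / n.factorial) • (innerₛₗ ℂ).flip with hB'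
  have happ : ∀ x y, B' x y = B x y - B (top n) (top n) / n.factorial * inner ℂ y x :=
    fun x y => rfl
  have hinv : IsInvariantForm B' := fun g x y => by
    rw [happ, happ, hB, isUnitaryRep_rho]
  have h0 : B' = 0 := by
    refine hinv.eq_zero_of_top_left fun b => ?_
    by_cases hb : b = Fin.last n
    · subst hb
      change B' (top n) (top n) = 0
      rw [happ, inner_top_top, div_mul_cancel₀ _ hn, sub_self]
    · refine hinv.mono_mono _ _ ?_
      have h1 : (b : ℕ) ≠ n := fun h => hb (Fin.ext h)
      simp only [Fin.val_last]
      omega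
  have := happ x y
  rw [h0] at this
  exact (sub_eq_zero.mp this.symm)

end Representations

/-! ### The maps `α` are equivariant isometries; throughout, `r = l + b`, `m = l + h`, `n = b + h`.
-/

section Alpha

theorem tensorToPoly_tmul (m n : ℕ) (f : P m) (g : P n) :
    tensorToPoly m n (f ⊗ₜ g) = rename Sum.inl (f : MvPolynomial (Fin 2) ℂ) *
      rename Sum.inr (g : MvPolynomial (Fin 2) ℂ) := rfl

theorem tensorToPoly_injective (m n : ℕ) : Function.Injective (tensorToPoly m n) :=
  Function.LeftInverse.injective (polyToTensor_tensorToPoly m n)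

/-- The simultaneous substitution `F(x, y) ↦ F(x g, y g)`. -/
def substXY (g : Matrix (Fin 2) (Fin 2) ℂ) : PolyXY →ₐ[ℂ] PolyXY :=
  aeval (Sum.elim (fun j => ∑ i, C (g i j) * X (Sum.inl i)) fun j => ∑ i, C (g i j) * X (Sum.inr i))

theorem substXY_rename_inl (g : Matrix (Fin 2) (Fin 2) ℂ) (f : MvPolynomial (Fin 2) ℂ) :
    substXY g (rename Sum.inl f) = rename Sum.inl (subst g f) := by
  have h : (substXY g).comp (rename Sum.inl) = (rename Sum.inl).comp (subst g) := by
    ext j : 1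
    simp [substXY, subst]
  exact AlgHom.congr_fun h f

theorem substXY_rename_inr (g : Matrix (Fin 2) (Fin 2) ℂ) (f : MvPolynomial (Fin 2) ℂ) :
    substXY g (rename Sum.inr f) = rename Sum.inr (subst g f) := by
  have h : (substXY g).comp (rename Sum.inr) = (rename Sum.inr).comp (subst g) := by
    ext j : 1
    simp [substXY, subst]
  exact AlgHom.congr_fun h f

theorem tensorToPoly_map_rho (m n : ℕ) (g : SU2) (z : P m ⊗[ℂ] P n) :
    tensorToPoly m n (TensorProduct.map (rho m g) (rho n g) z) =
      substXY g.1 (tensorToPoly m n z) := by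
  induction z with
  | zero => simp
  | add a b ha hb => simp only [map_add, ha, hb]
  | tmul f h =>
    rw [TensorProduct.map_tmul, tensorToPoly_tmul, tensorToPoly_tmul, map_mul,
      substXY_rename_inl, substXY_rename_inr, rho_coe, rho_coe]

theorem DeltaYX_apply (F : PolyXY) :
    DeltaYX F = X (Sum.inr 0) * pderiv (Sum.inl 0) F + X (Sum.inr 1) * pderiv (Sum.inl 1) F := rfl

theorem GammaXY_apply (F : PolyXY) :
    GammaXY F = (X (Sum.inl 0) * X (Sum.inr 1) - X (Sum.inr 0) * X (Sum.inl 1)) * F := rfl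

theorem DeltaYX_mul (F F' : PolyXY) : DeltaYX (F * F') = DeltaYX F * F' + F * DeltaYX F' := by
  simp only [DeltaYX_apply, Derivation.leibniz, smul_eq_mul]; ring

theorem DeltaYX_X (i : Fin 2 ⊕ Fin 2) :
    DeltaYX (X i) = Sum.elim (fun j => X (Sum.inr j)) (fun _ => 0) i := by
  rw [DeltaYX_apply, pderiv_X, pderiv_X]
  rcases i with i | i
  · fin_cases i <;> simp
  · simp

theorem DeltaYX_C_mul (c : ℂ) (F : PolyXY) : DeltaYX (C c * F) = C c * DeltaYX F := by
  rw [C_mul', C_mul', map_smul]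

theorem substXY_DeltaYX (g : Matrix (Fin 2) (Fin 2) ℂ) (F : PolyXY) :
    substXY g (DeltaYX F) = DeltaYX (substXY g F) := by
  have hX (i) : substXY g (DeltaYX (X i)) = DeltaYX (substXY g (X i)) := by
    rcases i with i | i <;>
      simp only [DeltaYX_X, substXY, aeval_X, Sum.elim_inl, Sum.elim_inr, map_sum, DeltaYX_C_mul,
        map_zero, mul_zero, Finset.sum_const_zero]
  induction F using MvPolynomial.induction_on with
  | C a => simp [DeltaYX_apply, substXY, algebraMap_eq]
  | add a b ha hb => rw [map_add, map_add, map_add, map_add, ha, hb]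
  | mul_X p i hp =>
    rw [DeltaYX_mul, map_add (substXY g), map_mul (substXY g), map_mul (substXY g),
      map_mul (substXY g), DeltaYX_mul, hp, hX]

/-- The polynomial `x₁y₂ - y₁x₂` is a determinant, so the substitution multiplies it by `det g = 1`.
-/
theorem substXY_GammaXY {g : Matrix (Fin 2) (Fin 2) ℂ} (hg : g.det = 1) (F : PolyXY) :
    substXY g (GammaXY F) = GammaXY (substXY g F) := by
  have h : (C (g 0 0) * C (g 1 1) - C (g 0 1) * C (g 1 0) : PolyXY) = 1 := by
    rw [← C_mul, ← C_mul, ← C_sub, ← Matrix.det_fin_two, hg, C_1]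
  simp only [GammaXY_apply, map_mul, map_sub]
  congr 1
  simp only [substXY, aeval_X, Sum.elim_inl, Sum.elim_inr, Fin.sum_univ_two]
  linear_combination (X (Sum.inl 0) * X (Sum.inr 1) - X (Sum.inr 0) * X (Sum.inl 1) : PolyXY) * h

theorem rename_mul_rename_mem {m n : ℕ} {f g : MvPolynomial (Fin 2) ℂ} (hf : f.IsHomogeneous m)
    (hg : g.IsHomogeneous n) :
    rename Sum.inl f * rename Sum.inr g ∈ LinearMap.range (tensorToPoly m n) :=
  ⟨⟨f, hf⟩ ⊗ₜ ⟨g, hg⟩, rfl⟩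

/-- Bidegrees are tracked as ranges of `tensorToPoly`, because `polyToTensor` discards the monomials
of every other bidegree and inverts `tensorToPoly` only there. -/
theorem DeltaYX_mem {m n : ℕ} {F : PolyXY} (hF : F ∈ LinearMap.range (tensorToPoly (m + 1) n)) :
    DeltaYX F ∈ LinearMap.range (tensorToPoly m (n + 1)) := by
  obtain ⟨z, rfl⟩ := hF
  induction z with
  | zero => simp
  | add a b ha hb => rw [map_add, map_add]; exact add_mem ha hb
  | tmul f g =>
    have h0 : ∀ i, pderiv (Sum.inl i) (rename Sum.inr (g : MvPolynomial (Fin 2) ℂ) : PolyXY) = 0 := by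
      intro i
      refine pderiv_eq_zero_of_notMem_vars fun h => ?_
      have := vars_rename (Sum.inr : Fin 2 → Fin 2 ⊕ Fin 2) (g : MvPolynomial (Fin 2) ℂ) h
      simp at this
    have h1 : ∀ i, pderiv (Sum.inl i) (rename Sum.inl (f : MvPolynomial (Fin 2) ℂ) : PolyXY) =
        rename Sum.inl (pderiv i (f : MvPolynomial (Fin 2) ℂ)) := fun i =>
      pderiv_rename Sum.inl_injective i _
    have h2 : DeltaYX (tensorToPoly (m + 1) n (f ⊗ₜ g)) =
        rename Sum.inl (pderiv 0 (f : MvPolynomial (Fin 2) ℂ)) *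
          rename Sum.inr ((g : MvPolynomial (Fin 2) ℂ) * X 0) +
        rename Sum.inl (pderiv 1 (f : MvPolynomial (Fin 2) ℂ)) *
          rename Sum.inr ((g : MvPolynomial (Fin 2) ℂ) * X 1) := by
      rw [tensorToPoly_tmul, DeltaYX_mul, DeltaYX_apply, DeltaYX_apply, h0, h0, h1, h1]
      simp only [map_mul, rename_X]
      ring
    rw [h2]
    exact add_mem
      (rename_mul_rename_mem (IsHomogeneous.pderiv f.2) (IsHomogeneous.mul g.2 (isHomogeneous_X _ _)))
      (rename_mul_rename_mem (IsHomogeneous.pderiv f.2) (IsHomogeneous.mul g.2 (isHomogeneous_X _ _)))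

theorem GammaXY_mem {m n : ℕ} {F : PolyXY} (hF : F ∈ LinearMap.range (tensorToPoly m n)) :
    GammaXY F ∈ LinearMap.range (tensorToPoly (m + 1) (n + 1)) := by
  obtain ⟨z, rfl⟩ := hF
  induction z with
  | zero => simp
  | add a b ha hb => rw [map_add, map_add]; exact add_mem ha hb
  | tmul f g =>
    have h2 : GammaXY (tensorToPoly m n (f ⊗ₜ g)) =
        rename Sum.inl ((f : MvPolynomial (Fin 2) ℂ) * X 0) *
          rename Sum.inr ((g : MvPolynomial (Fin 2) ℂ) * X 1) -
        rename Sum.inl ((f : MvPolynomial (Fin 2) ℂ) * X 1) *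
          rename Sum.inr ((g : MvPolynomial (Fin 2) ℂ) * X 0) := by
      rw [tensorToPoly_tmul, GammaXY_apply]
      simp only [map_mul, rename_X]
      ring
    rw [h2]
    exact sub_mem
      (rename_mul_rename_mem (IsHomogeneous.mul f.2 (isHomogeneous_X _ _))
        (IsHomogeneous.mul g.2 (isHomogeneous_X _ _)))
      (rename_mul_rename_mem (IsHomogeneous.mul f.2 (isHomogeneous_X _ _))
        (IsHomogeneous.mul g.2 (isHomogeneous_X _ _)))

theorem DeltaYX_pow_mem {m n : ℕ} (k : ℕ) {F : PolyXY}
    (hF : F ∈ LinearMap.range (tensorToPoly (m + k) n)) :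
    (DeltaYX ^ k) F ∈ LinearMap.range (tensorToPoly m (n + k)) := by
  induction k generalizing m with
  | zero => simpa using hF
  | succ k ih =>
    rw [pow_succ', Module.End.mul_apply]
    exact DeltaYX_mem (ih (by rwa [add_assoc, add_comm 1]))

theorem GammaXY_pow_mem {m n : ℕ} (k : ℕ) {F : PolyXY}
    (hF : F ∈ LinearMap.range (tensorToPoly m n)) :
    (GammaXY ^ k) F ∈ LinearMap.range (tensorToPoly (m + k) (n + k)) := by
  induction k with
  | zero => simpa using hF
  | succ k ih =>
    rw [pow_succ', Module.End.mul_apply]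
    exact GammaXY_mem ih

theorem tensorToPoly_alpha (l b h : ℕ) (f : P (l + b)) :
    tensorToPoly (l + h) (b + h) (alpha (l + b) (l + h) (b + h) h f) =
      (Real.sqrt (cgCoeff (l + h) (b + h) h) : ℂ) • (GammaXY ^ h) ((DeltaYX ^ b)
        (rename Sum.inl (f : MvPolynomial (Fin 2) ℂ))) := by
  have hf : (rename Sum.inl (f : MvPolynomial (Fin 2) ℂ) : PolyXY) ∈
      LinearMap.range (tensorToPoly (l + b) 0) := by
    simpa using rename_mul_rename_mem f.2 (isHomogeneous_one (Fin 2) ℂ)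
  have h1 := GammaXY_pow_mem h (DeltaYX_pow_mem b hf)
  rw [zero_add] at h1
  obtain ⟨z, hz⟩ := h1
  simp only [alpha, LinearMap.smul_apply, LinearMap.comp_apply, map_smul, Nat.add_sub_cancel,
    AlgHom.toLinearMap_apply, Submodule.subtype_apply]
  rw [← hz, polyToTensor_tensorToPoly]

theorem isTensorIntertwiner_alpha (l b h : ℕ) :
    IsTensorIntertwiner (rho (l + b)) (rho (l + h)) (rho (b + h))
      (alpha (l + b) (l + h) (b + h) h) := by
  intro g f
  have hΔ (k : ℕ) (F : PolyXY) : substXY g.1 ((DeltaYX ^ k) F) = (DeltaYX ^ k) (substXY g.1 F) := by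
    induction k with
    | zero => simp
    | succ k ih => rw [pow_succ', Module.End.mul_apply, substXY_DeltaYX, ih, Module.End.mul_apply]
  have hΓ (k : ℕ) (F : PolyXY) : substXY g.1 ((GammaXY ^ k) F) = (GammaXY ^ k) (substXY g.1 F) := by
    induction k with
    | zero => simp
    | succ k ih =>
      rw [pow_succ', Module.End.mul_apply,
        substXY_GammaXY (Matrix.mem_specialUnitaryGroup_iff.mp g.2).2, ih, Module.End.mul_apply]
  apply tensorToPoly_injective
  rw [tensorToPoly_map_rho, tensorToPoly_alpha, tensorToPoly_alpha, map_smul, hΓ, hΔ,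
    substXY_rename_inl, rho_coe]

/-- In the variables `l = m - h` and `b = n - h` the recursion, by induction on `n`, has a closed
product solution. -/
theorem cgCoeff_eq (l b h : ℕ) : cgCoeff (l + h) (b + h) h =
    l.factorial * (l + b + 1) / (h.factorial * b.factorial * (l + b + h + 1).factorial) := by
  obtain ⟨n, hn⟩ : ∃ n, b + h = n := ⟨_, rfl⟩
  induction n generalizing l b h with
  | zero =>
    obtain ⟨rfl, rfl⟩ : b = 0 ∧ h = 0 := by omega
    have : (l.factorial : ℝ) ≠ 0 := by positivity
    simp only [add_zero, cgCoeff, Nat.factorial_succ, Nat.factorial_zero]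
    push_cast
    field_simp
    simp
  | succ n ih =>
    rcases h with _ | h
    · obtain rfl : b = n + 1 := by omega
      have h1 := ih (l + 1) n 0 rfl
      simp only [add_zero] at h1 ⊢
      rw [cgCoeff, h1]
      have e1 : l + 1 + n + 1 = l + (n + 1) + 1 := by ring
      rw [e1, Nat.factorial_succ l, Nat.factorial_succ n]
      push_cast
      have : ((l : ℝ) + 1) ≠ 0 := by positivity
      field_simp
      ring
    · obtain rfl : n = b + h := by omega
      have h1 := ih l b h rfl
      rw [← add_assoc, ← add_assoc, cgCoeff, Nat.add_sub_cancel, h1]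
      -- Here `b = 0` is the boundary case `h = n` of the recursion, where the second summand is
      -- absent.
      rcases b with _ | b
      · rw [if_neg (by omega), Nat.factorial_succ h,
          show l + 0 + (h + 1) + 1 = (l + h + 1) + 1 by ring, Nat.factorial_succ (l + h + 1)]
        simp only [add_zero, Nat.factorial_zero]
        push_cast
        have : ((l : ℝ) + h + 1 + 1) ≠ 0 := by positivity
        field_simp
        ring
      · have h2 := ih (l + 1) b (h + 1) (by ring)
        rw [if_pos (by omega), show l + h + 1 + 1 = l + 1 + (h + 1) by ring,
          show b + 1 + h = b + (h + 1) by ring, h2, Nat.factorial_succ h, Nat.factorial_succ b,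
          Nat.factorial_succ l,
          show l + 1 + b + (h + 1) + 1 = (l + b + h + 2) + 1 by ring,
          show l + (b + 1) + h + 1 = l + b + h + 2 by ring,
          show l + (b + 1) + (h + 1) + 1 = (l + b + h + 2) + 1 by ring,
          Nat.factorial_succ (l + b + h + 2)]
        push_cast
        have : ((l : ℝ) + b + h + 2 + 1) ≠ 0 := by positivity
        field_simp
        ring

/-- Compare coefficients of `X^h` in `(1 - X)^(-(b+1)) (1 - X)^(-(l+1)) = (1 - X)^(-(l+b+2))`. -/
theorem sum_choose_mul_choose (l b h : ℕ) :
    ∑ j ∈ Finset.range (h + 1), (l + h - j).choose l * (b + j).choose b =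
      (l + b + 1 + h).choose (l + b + 1) := by
  have h1 := congrArg (fun u : (PowerSeries ℤ)ˣ => PowerSeries.coeff h u.val)
    (PowerSeries.invOneSubPow_add ℤ (b + 1) (l + 1))
  rw [show b + 1 + (l + 1) = l + b + 1 + 1 by ring] at h1
  simp only [Units.val_mul, PowerSeries.invOneSubPow_val_succ_eq_mk_add_choose,
    PowerSeries.coeff_mul, PowerSeries.coeff_mk] at h1
  rw [Finset.Nat.sum_antidiagonal_eq_sum_range_succ
    (fun i j => ((b + i).choose b : ℤ) * ((l + j).choose l : ℤ))] at h1
  zify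
  rw [h1]
  refine Finset.sum_congr rfl fun j hj => ?_
  have := Finset.mem_range.mp hj
  rw [mul_comm, Nat.add_sub_assoc (by omega)]

theorem DeltaYX_pow_monomial (l k j : ℕ) :
    (DeltaYX ^ k) (X (Sum.inl 0) ^ (l + k) * X (Sum.inr 0) ^ j) =
      ((l + k).factorial / l.factorial : ℂ) •
        (X (Sum.inl 0) ^ l * X (Sum.inr 0) ^ (j + k) : PolyXY) := by
  induction k generalizing j with
  | zero =>
    have : (l.factorial : ℂ) ≠ 0 := by exact_mod_cast l.factorial_ne_zero
    simp [this]
  | succ k ih =>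
    have h1 : DeltaYX (X (Sum.inl 0) ^ (l + k + 1) * X (Sum.inr 0) ^ j) =
        (l + k + 1 : ℂ) • (X (Sum.inl 0) ^ (l + k) * X (Sum.inr 0) ^ (j + 1) : PolyXY) := by
      simp [DeltaYX_apply, Derivation.leibniz, Derivation.leibniz_pow, pderiv_X, smul_eq_C_mul]
      ring
    rw [pow_succ, Module.End.mul_apply, ← add_assoc, h1, map_smul, ih, smul_smul,
      Nat.factorial_succ]
    push_cast
    congr 1
    · ring
    · ring

/-- `Δ^b` turns `x₁^(l+b)` into a multiple of `x₁^l y₁^b`, and the binomial expansion of `Γ^h` then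
produces pairwise distinct, hence orthogonal, monomials. -/
theorem alpha_top (l b h : ℕ) :
    alpha (l + b) (l + h) (b + h) h (top (l + b)) =
      (Real.sqrt (cgCoeff (l + h) (b + h) h) * ((l + b).factorial / l.factorial) : ℂ) •
        ∑ j : Fin (h + 1), ((-1) ^ (j : ℕ) * h.choose j : ℂ) •
          (mono (l + h) ⟨l + h - j, by omega⟩ ⊗ₜ[ℂ] mono (b + h) ⟨b + j, by omega⟩) := by
  apply tensorToPoly_injective
  have hΓ : ∀ F : PolyXY, (GammaXY ^ h) F =
      (X (Sum.inl 0) * X (Sum.inr 1) - X (Sum.inr 0) * X (Sum.inl 1)) ^ h * F := by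
    intro F
    rw [GammaXY, LinearMap.pow_mulLeft, LinearMap.mulLeft_apply]
  have h1 := DeltaYX_pow_monomial l b 0
  rw [pow_zero, mul_one, zero_add] at h1
  rw [tensorToPoly_alpha, top_coe, map_pow, rename_X, h1, map_smul, hΓ, map_smul, smul_smul,
    sub_eq_neg_add, add_pow, map_sum, Finset.sum_mul,
    ← Fin.sum_univ_eq_sum_range (fun j => (-(X (Sum.inr 0) * X (Sum.inl 1))) ^ j *
      (X (Sum.inl 0) * X (Sum.inr 1)) ^ (h - j) * ((h.choose j : ℕ) : PolyXY) *
        (X (Sum.inl 0) ^ l * X (Sum.inr 0) ^ b))]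
  congr 1
  refine Finset.sum_congr rfl fun j _ => ?_
  have hj := Nat.lt_succ_iff.mp j.2
  rw [map_smul, tensorToPoly_tmul, mono_coe, mono_coe]
  simp only [map_mul, map_pow, rename_X]
  rw [show l + h - (l + h - j) = (j : ℕ) by omega, show b + h - (b + j) = h - (j : ℕ) by omega,
    show l + h - (j : ℕ) = l + (h - j) by omega, smul_eq_C_mul, neg_pow]
  simp only [map_mul, map_pow, map_neg, map_one, map_natCast, pow_add]
  ring

theorem inner_smul_left_tensor {m n : ℕ} (c : ℂ) (u v : P m ⊗[ℂ] P n) :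
    inner ℂ (c • u) v = starRingEnd ℂ c * inner ℂ u v :=
  inner_smul_left (𝕜 := ℂ) (E := P m ⊗[ℂ] P n) u v c

theorem inner_smul_right_tensor {m n : ℕ} (c : ℂ) (u v : P m ⊗[ℂ] P n) :
    inner ℂ u (c • v) = c * inner ℂ u v :=
  inner_smul_right (𝕜 := ℂ) (E := P m ⊗[ℂ] P n) u v c

theorem inner_alpha_top (l b h : ℕ) :
    inner ℂ (alpha (l + b) (l + h) (b + h) h (top (l + b)))
      (alpha (l + b) (l + h) (b + h) h (top (l + b))) = ((l + b).factorial : ℂ) := by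
  have hc : (0 : ℝ) ≤ cgCoeff (l + h) (b + h) h := by
    rw [cgCoeff_eq]; positivity
  -- Pulling out the factorials that do not depend on `j` leaves the summand of
  -- `sum_choose_mul_choose`.
  have hterm : ∀ j : Fin (h + 1), (h.choose j * h.choose j : ℂ) *
      (((l + h - j).factorial * (l + h - (l + h - j)).factorial) *
        ((b + j).factorial * (b + h - (b + j)).factorial)) =
      (h.factorial * h.factorial * l.factorial * b.factorial : ℂ) *
        ((l + h - j).choose l * (b + j).choose b : ℕ) := by
    intro j
    have hj := Nat.lt_succ_iff.mp j.2
    rw [show l + h - (l + h - j) = (j : ℕ) by omega, show b + h - (b + j) = h - (j : ℕ) by omega,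
      show l + h - (j : ℕ) = l + (h - j) by omega]
    have e1 : ((l + (h - j)).factorial : ℂ) =
        (l + (h - j)).choose l * l.factorial * (h - j).factorial := by
      rw [Nat.choose_symm_add]
      exact_mod_cast (Nat.add_choose_mul_factorial_mul_factorial l (h - j)).symm
    have e2 : ((b + j).factorial : ℂ) = (b + j).choose b * b.factorial * (j : ℕ).factorial := by
      rw [Nat.choose_symm_add]
      exact_mod_cast (Nat.add_choose_mul_factorial_mul_factorial b j).symm
    have e3 : (h.factorial : ℂ) = h.choose j * (j : ℕ).factorial * (h - j).factorial := by
      exact_mod_cast (Nat.choose_mul_factorial_mul_factorial hj).symm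
    rw [e1, e2, e3]
    push_cast
    ring
  have hnorm : inner ℂ (∑ j : Fin (h + 1), ((-1) ^ (j : ℕ) * h.choose j : ℂ) •
      (mono (l + h) ⟨l + h - j, by omega⟩ ⊗ₜ[ℂ] mono (b + h) ⟨b + j, by omega⟩))
      (∑ j : Fin (h + 1), ((-1) ^ (j : ℕ) * h.choose j : ℂ) •
      (mono (l + h) ⟨l + h - j, by omega⟩ ⊗ₜ[ℂ] mono (b + h) ⟨b + j, by omega⟩)) =
      (h.factorial * h.factorial * l.factorial * b.factorial : ℂ) *
        ((l + b + 1 + h).choose (l + b + 1) : ℕ) := by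
    rw [← sum_choose_mul_choose, ← Fin.sum_univ_eq_sum_range
      (fun j => (l + h - j).choose l * (b + j).choose b), Nat.cast_sum, Finset.mul_sum, sum_inner]
    refine Finset.sum_congr rfl fun j _ => ?_
    rw [← hterm, inner_sum, Finset.sum_eq_single j]
    · rw [inner_smul_left_tensor, inner_smul_right_tensor]
      rw [TensorProduct.inner_tmul, inner_mono, inner_mono, if_pos rfl, if_pos rfl]
      simp only [map_mul, map_pow, map_neg, map_one, map_natCast]
      have : ((-1 : ℂ) ^ (j : ℕ)) * (-1) ^ (j : ℕ) = 1 := by rw [← mul_pow]; simp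
      linear_combination ((h.choose j * h.choose j : ℂ) *
        (((l + h - j).factorial * (l + h - (l + h - j)).factorial) *
        ((b + j).factorial * (b + h - (b + j)).factorial))) * this
    · intro k _ hk
      have hk' : (j : ℕ) ≠ k := fun h => hk (Fin.ext h.symm)
      rw [inner_smul_left_tensor, inner_smul_right_tensor]
      rw [TensorProduct.inner_tmul, inner_mono, inner_mono, if_neg (c := _ = (_ : Fin (b + h + 1)))]
      · simp
      · intro heq
        have := congrArg Fin.val heq
        simp only at this
        omega
    · simp
  rw [alpha_top]
  rw [inner_smul_left_tensor, inner_smul_right_tensor]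
  rw [hnorm, map_mul, map_div₀, map_natCast, map_natCast, Complex.conj_ofReal]
  have hsq : (Real.sqrt (cgCoeff (l + h) (b + h) h) : ℂ) * Real.sqrt (cgCoeff (l + h) (b + h) h) =
      l.factorial * (l + b + 1) / (h.factorial * b.factorial * (l + b + h + 1).factorial) := by
    rw [← Complex.ofReal_mul, Real.mul_self_sqrt hc, cgCoeff_eq]
    push_cast; rfl
  have hch : (((l + b + 1 + h).choose (l + b + 1) : ℕ) : ℂ) * ((l + b + 1) * (l + b).factorial) *
      h.factorial = (l + b + h + 1).factorial := by
    have := Nat.add_choose_mul_factorial_mul_factorial (l + b + 1) h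
    rw [← Nat.choose_symm_add] at this
    rw [Nat.factorial_succ, show l + b + 1 + h = l + b + h + 1 by ring] at this
    rw [show l + b + 1 + h = l + b + h + 1 by ring]
    exact_mod_cast this
  have n1 : (l.factorial : ℂ) ≠ 0 := by exact_mod_cast l.factorial_ne_zero
  have n2 : (b.factorial : ℂ) ≠ 0 := by exact_mod_cast b.factorial_ne_zero
  have n3 : (h.factorial : ℂ) ≠ 0 := by exact_mod_cast h.factorial_ne_zero
  have n4 : ((l + b + h + 1).factorial : ℂ) ≠ 0 := by exact_mod_cast Nat.factorial_ne_zero _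
  calc _ = (Real.sqrt (cgCoeff (l + h) (b + h) h) : ℂ) * Real.sqrt (cgCoeff (l + h) (b + h) h) *
        ((l + b).factorial / l.factorial) ^ 2 * ((h.factorial * h.factorial * l.factorial *
        b.factorial : ℂ) * ((l + b + 1 + h).choose (l + b + 1) : ℕ)) := by ring
    _ = (l + b).factorial * ((((l + b + 1 + h).choose (l + b + 1) : ℕ) : ℂ) *
        ((l + b + 1) * (l + b).factorial) * h.factorial) / (l + b + h + 1).factorial := by
      rw [hsq]; field_simp
    _ = _ := by rw [hch]; field_simp

/-- The pulled back inner product is an invariant form on an irreducible space, so Schur's lemma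
reduces the claim to `inner_alpha_top`. -/
theorem inner_alpha (l b h : ℕ) (x y : P (l + b)) :
    inner ℂ (alpha (l + b) (l + h) (b + h) h x) (alpha (l + b) (l + h) (b + h) h y) =
      inner ℂ x y := by
  set α := alpha (l + b) (l + h) (b + h) h with hα
  let B : P (l + b) →ₗ[ℂ] P (l + b) →ₗ⋆[ℂ] ℂ :=
    LinearMap.mk₂'ₛₗ (RingHom.id ℂ) (starRingEnd ℂ) (fun x y => inner ℂ (α y) (α x))
      (fun x x' y => by simp only [map_add, inner_add_right])
      (fun c x y => by
        rw [map_smul]; exact inner_smul_right_tensor _ _ _)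
      (fun x y y' => by simp only [map_add, inner_add_left])
      (fun c x y => by
        rw [map_smul]; exact inner_smul_left_tensor _ _ _)
  have hB : IsInvariantForm B := by
    intro g x y
    change inner ℂ (α (rho _ g y)) (α (rho _ g x)) = inner ℂ (α y) (α x)
    rw [isTensorIntertwiner_alpha, isTensorIntertwiner_alpha, ← LinearMap.adjoint_inner_right,
      TensorProduct.adjoint_map, (isUnitaryRep_rho _).adjoint_eq, (isUnitaryRep_rho _).adjoint_eq,
      ← LinearMap.comp_apply, ← TensorProduct.map_comp]
    congr 1
    have (k : ℕ) : rho k g⁻¹ ∘ₗ rho k g = LinearMap.id := by ext1; simp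
    rw [this, this, TensorProduct.map_id, LinearMap.id_apply]
  have h1 := hB.eq_smul_inner y x
  have h2 : B (top (l + b)) (top (l + b)) = ((l + b).factorial : ℂ) := inner_alpha_top l b h
  rw [h2, div_self (by exact_mod_cast (l + b).factorial_ne_zero), one_mul] at h1
  exact h1

end Alpha

/-! ### Simplices from barycentric coordinates. -/

section Simplex

variable {ι V : Type*} [AddCommGroup V] [Module ℝ V]
  {v : ι → V} {A : Set V} {c : ι → V →ₗ[ℝ] ℝ}

theorem affineIndependent_of_dual [DecidableEq ι] (hc : ∀ i j, c i (v j) = if i = j then 1 else 0) :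
    AffineIndependent ℝ v := by
  rw [affineIndependent_iff]
  intro s w _ hw i hi
  have h := congrArg (c i) hw
  simpa [hc, hi] using h

theorem eq_convexHull_of_barycentric [Fintype ι] (hA : Convex ℝ A) (hv : ∀ i, v i ∈ A)
    (h0 : ∀ x ∈ A, ∀ i, 0 ≤ c i x) (h1 : ∀ x ∈ A, ∑ i, c i x = 1)
    (hx : ∀ x ∈ A, x = ∑ i, c i x • v i) : A = convexHull ℝ (Set.range v) := by
  refine Set.Subset.antisymm (fun x hxA => ?_) (convexHull_min (Set.range_subset_iff.mpr hv) hA)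
  rw [hx x hxA]
  exact (convex_convexHull ℝ _).sum_mem (fun i _ => h0 x hxA i) (h1 x hxA)
    fun i _ => subset_convexHull ℝ _ ⟨i, rfl⟩

theorem extremePoints_of_barycentric [Fintype ι] [DecidableEq ι] (hA : Convex ℝ A) (hv : ∀ i, v i ∈ A)
    (hc : ∀ i j, c i (v j) = if i = j then 1 else 0)
    (h0 : ∀ x ∈ A, ∀ i, 0 ≤ c i x) (h1 : ∀ x ∈ A, ∑ i, c i x = 1)
    (hx : ∀ x ∈ A, x = ∑ i, c i x • v i) : A.extremePoints ℝ = Set.range v := by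
  apply Set.Subset.antisymm
  · rw [eq_convexHull_of_barycentric hA hv h0 h1 hx]
    exact extremePoints_convexHull_subset
  · rintro _ ⟨i, rfl⟩
    rw [mem_extremePoints_iff_left]
    refine ⟨hv i, fun x hxA y hyA hxy => ?_⟩
    obtain ⟨a, b, ha, hb, -, hab⟩ := hxy
    -- The coordinate `c j` vanishes at `v i`, which is a positive combination of two points where
    -- it is nonnegative.
    have hz : ∀ j, j ≠ i → c j x = 0 := by
      intro j hj
      have h := congrArg (c j) hab
      rw [map_add, map_smul, map_smul, hc, if_neg hj, smul_eq_mul, smul_eq_mul] at h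
      have h2 := mul_nonneg hb.le (h0 y hyA j)
      nlinarith [h0 x hxA j, mul_nonneg ha.le (h0 x hxA j), mul_pos ha hb]
    have hi : c i x = 1 := by
      rw [← h1 x hxA, Finset.sum_eq_single i (fun j _ hj => hz j hj) (by simp)]
    rw [hx x hxA, Finset.sum_eq_single i (fun j _ hj => by rw [hz j hj, zero_smul]) (by simp), hi,
      one_smul]

end Simplex

/-! ### Linear structure of covariant maps and convexity of the set of channels. -/

section Covariant

variable {G H K : Type*} [Group G]
  [NormedAddCommGroup H] [InnerProductSpace ℂ H] [FiniteDimensional ℂ H]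
  [NormedAddCommGroup K] [InnerProductSpace ℂ K] [FiniteDimensional ℂ K]
  {πH : Representation ℂ G H} {πK : Representation ℂ G K}
  {Φ Ψ : Module.End ℂ H →ₗ[ℂ] Module.End ℂ K}

theorem IsCovariant.add (hΦ : IsCovariant πH πK Φ) (hΨ : IsCovariant πH πK Ψ) :
    IsCovariant πH πK (Φ + Ψ) := fun g A => by
  rw [LinearMap.add_apply, LinearMap.add_apply, hΦ, hΨ, LinearMap.add_comp, LinearMap.comp_add]

theorem IsCovariant.smul (c : ℂ) (hΦ : IsCovariant πH πK Φ) : IsCovariant πH πK (c • Φ) :=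
  fun g A => by
    rw [LinearMap.smul_apply, LinearMap.smul_apply, hΦ, LinearMap.smul_comp, LinearMap.comp_smul]

theorem IsCovariant.sub (hΦ : IsCovariant πH πK Φ) (hΨ : IsCovariant πH πK Ψ) :
    IsCovariant πH πK (Φ - Ψ) := by
  rw [sub_eq_add_neg, ← neg_one_smul ℂ Ψ]
  exact hΦ.add (hΨ.smul _)

theorem IsCovariant.sum_smul {ι : Type*} [Fintype ι] (c : ι → ℂ)
    {Φ : ι → Module.End ℂ H →ₗ[ℂ] Module.End ℂ K} (hΦ : ∀ i, IsCovariant πH πK (Φ i)) :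
    IsCovariant πH πK (∑ i, c i • Φ i) := by
  refine Finset.sum_induction _ (IsCovariant πH πK) (fun _ _ => IsCovariant.add)
    (fun g A => by simp) fun i _ => (hΦ i).smul (c i)

theorem span_eq_top_of_card_eq {ι : Type*} [Fintype ι] {v : ι → K →ₗ[ℂ] H}
    (hv : LinearIndependent ℂ v)
    (h : Fintype.card ι = Module.finrank ℂ K * Module.finrank ℂ H) :
    Submodule.span ℂ (Set.range v) = ⊤ :=
  hv.span_eq_top_of_card_eq_finrank' (h.trans (Module.finrank_linearMap ℂ ℂ K H).symm)

theorem convex_covariantChannels (πH : Representation ℂ G H) (πK : Representation ℂ G K) :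
    Convex ℝ (covariantChannels πH πK) := by
  intro Φ hΦ Ψ hΨ a b ha hb hab
  have h : a • Φ + b • Ψ = (a : ℂ) • Φ + (b : ℂ) • Ψ := rfl
  have ha' : (0 : ℂ) ≤ a := Complex.zero_le_real.mpr ha
  have hb' : (0 : ℂ) ≤ b := Complex.zero_le_real.mpr hb
  rw [h]
  refine ⟨⟨fun k A hA w => ?_, fun A => ?_⟩,
    IsCovariant.add (IsCovariant.smul _ hΦ.2) (IsCovariant.smul _ hΨ.2)⟩
  · simp only [LinearMap.add_apply, LinearMap.smul_apply, inner_add_right, inner_smul_right,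
      Finset.sum_add_distrib, ← Finset.mul_sum]
    exact add_nonneg (mul_nonneg ha' (hΦ.1.1 k A hA w)) (mul_nonneg hb' (hΨ.1.1 k A hA w))
  · rw [LinearMap.add_apply, LinearMap.smul_apply, LinearMap.smul_apply, map_add, map_smul,
      map_smul, hΦ.1.2, hΨ.1.2, ← add_smul, ← Complex.ofReal_add, hab]
    simp

end Covariant

/-! ### Choi forms on the blocks of Kraus operators. -/

section Blocks

variable {r m n n' : ℕ} {α : P r →ₗ[ℂ] P m ⊗[ℂ] P n} {α' : P r →ₗ[ℂ] P m ⊗[ℂ] P n'}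
  {Φ : Module.End ℂ (P r) →ₗ[ℂ] Module.End ℂ (P m)}

/-- The Choi form restricted to the spans of the Kraus operators of two Stinespring operators. -/
def krausForm (Φ : Module.End ℂ (P r) →ₗ[ℂ] Module.End ℂ (P m)) (α : P r →ₗ[ℂ] P m ⊗[ℂ] P n)
    (α' : P r →ₗ[ℂ] P m ⊗[ℂ] P n') : P n →ₗ[ℂ] P n' →ₗ⋆[ℂ] ℂ :=
  LinearMap.mk₂'ₛₗ (RingHom.id ℂ) (starRingEnd ℂ)
    (fun x y => choiForm Φ (kraus α x) (kraus α' y))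
    (fun x x' y => by simp only [map_add, LinearMap.add_apply])
    (fun c x y => by rw [map_smul, map_smul]; rfl)
    (fun x y y' => by simp only [map_add])
    (fun c x y => by rw [map_smul, map_smulₛₗ])

theorem isInvariantForm_krausForm (hΦ : IsCovariant (rho r) (rho m) Φ)
    (hα : IsTensorIntertwiner (rho r) (rho m) (rho n) α)
    (hα' : IsTensorIntertwiner (rho r) (rho m) (rho n') α') :
    IsInvariantForm (krausForm Φ α α') := by
  intro g x y
  change choiForm Φ (kraus α (rho n g x)) (kraus α' (rho n' g y)) =
    choiForm Φ (kraus α x) (kraus α' y)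
  rw [kraus_intertwiner (isUnitaryRep_rho r) (isUnitaryRep_rho m) (isUnitaryRep_rho n) hα,
    kraus_intertwiner (isUnitaryRep_rho r) (isUnitaryRep_rho m) (isUnitaryRep_rho n') hα',
    choiForm_covariant (isUnitaryRep_rho m) hΦ]

theorem choiForm_kraus_of_ne (hΦ : IsCovariant (rho r) (rho m) Φ)
    (hα : IsTensorIntertwiner (rho r) (rho m) (rho n) α)
    (hα' : IsTensorIntertwiner (rho r) (rho m) (rho n') α') (hn : n ≠ n') (x : P n) (y : P n') :
    choiForm Φ (kraus α x) (kraus α' y) = 0 :=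
  LinearMap.congr_fun (LinearMap.congr_fun
    ((isInvariantForm_krausForm hΦ hα hα').eq_zero_of_ne hn) x) y

theorem choiForm_kraus (hΦ : IsCovariant (rho r) (rho m) Φ)
    (hα : IsTensorIntertwiner (rho r) (rho m) (rho n) α) (x y : P n) :
    choiForm Φ (kraus α x) (kraus α y) =
      choiForm Φ (kraus α (top n)) (kraus α (top n)) / n.factorial * inner ℂ y x :=
  (isInvariantForm_krausForm hΦ hα hα).eq_smul_inner x y

theorem isCovariant_depolarizing_rho (r m : ℕ) :
    IsCovariant (rho r) (rho m) (depolarizing (P r) (P m)) :=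
  isCovariant_depolarizing (isUnitaryRep_rho r) (isUnitaryRep_rho m)

/-- On the block, the Hilbert–Schmidt form is a multiple of the inner product. If it vanished at the
top vector it would vanish on the whole block, forcing all Kraus operators, and then `α`, to be
zero. -/
theorem kraus_top_ne_zero (hα : IsTensorIntertwiner (rho r) (rho m) (rho n) α) (hα0 : α ≠ 0) :
    kraus α (top n) ≠ 0 := by
  intro h0
  have hk : ∀ x, kraus α x = 0 := by
    intro x
    by_contra hx
    have h1 := choiForm_depolarizing_self_pos hx
    rw [choiForm_kraus (isCovariant_depolarizing_rho r m) hα, h0] at h1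
    simp at h1
  apply hα0
  have h2 : LinearMap.adjoint α = 0 := by
    refine TensorProduct.ext' fun w y => ?_
    rw [← kraus_apply, hk]; rfl
  rw [← LinearMap.adjoint_adjoint α, h2, map_zero]

theorem choiForm_stinespring_self_pos (hα : IsTensorIntertwiner (rho r) (rho m) (rho n) α)
    (hα0 : α ≠ 0) :
    0 < choiForm (stinespring α) (kraus α (top n)) (kraus α (top n)) := by
  have h1 := choiForm_depolarizing_self_pos (kraus_top_ne_zero hα hα0)
  have hn : (0 : ℂ) < n.factorial := by exact_mod_cast n.factorial_pos
  obtain ⟨ν, hν⟩ : ∃ ν, ν = choiForm (depolarizing (P r) (P m)) (kraus α (top n))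
    (kraus α (top n)) / n.factorial := ⟨_, rfl⟩
  have hpos : 0 < ν := hν ▸ div_pos h1 hn
  have h2 (x y : P n) : choiForm (depolarizing (P r) (P m)) (kraus α x) (kraus α y) =
      ν * inner ℂ y x := by
    rw [choiForm_kraus (isCovariant_depolarizing_rho r m) hα, hν]
  -- One factor `ν` comes from each of the two Hilbert–Schmidt products; Parseval gives the
  -- remaining `‖top n‖² = n!`.
  have h3 : choiForm (stinespring α) (kraus α (top n)) (kraus α (top n)) =
      ν * ν * n.factorial := by
    rw [choiForm_stinespring (stdOrthonormalBasis ℂ (P n)), ← inner_top_top,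
      ← (stdOrthonormalBasis ℂ (P n)).sum_inner_mul_inner (top n) (top n), Finset.mul_sum]
    refine Finset.sum_congr rfl fun t _ => ?_
    rw [h2, h2]; ring
  rw [h3]
  exact mul_pos (mul_pos hpos hpos) hn

theorem choiForm_stinespring_of_ne (hα : IsTensorIntertwiner (rho r) (rho m) (rho n) α)
    (hα' : IsTensorIntertwiner (rho r) (rho m) (rho n') α') (hn : n ≠ n') (x y : P n) :
    choiForm (stinespring α') (kraus α x) (kraus α y) = 0 := by
  rw [choiForm_stinespring (stdOrthonormalBasis ℂ (P n'))]
  refine Finset.sum_eq_zero fun t _ => ?_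
  rw [choiForm_kraus_of_ne (isCovariant_depolarizing_rho r m) hα hα' hn, zero_mul]

end Blocks

/-! ### The EPOSIC channels as vertices, and their dual coordinates. -/

section Channels

variable {r m l : ℕ}

theorem isTensorIntertwiner_alpha_of_le (hr : l ≤ r) (hm : l ≤ m) :
    IsTensorIntertwiner (rho r) (rho m) (rho (r + m - 2 * l))
      (alpha r m (r + m - 2 * l) (m - l)) := by
  obtain ⟨b, rfl⟩ := Nat.exists_eq_add_of_le hr
  obtain ⟨h, rfl⟩ := Nat.exists_eq_add_of_le hm
  rw [show l + b + (l + h) - 2 * l = b + h by omega, Nat.add_sub_cancel_left]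
  exact isTensorIntertwiner_alpha l b h

theorem inner_alpha_of_le (hr : l ≤ r) (hm : l ≤ m) (x y : P r) :
    inner ℂ (alpha r m (r + m - 2 * l) (m - l) x) (alpha r m (r + m - 2 * l) (m - l) y) =
      inner ℂ x y := by
  obtain ⟨b, rfl⟩ := Nat.exists_eq_add_of_le hr
  obtain ⟨h, rfl⟩ := Nat.exists_eq_add_of_le hm
  rw [show l + b + (l + h) - 2 * l = b + h by omega, Nat.add_sub_cancel_left]
  exact inner_alpha l b h x y

theorem alpha_ne_zero (hr : l ≤ r) (hm : l ≤ m) : alpha r m (r + m - 2 * l) (m - l) ≠ 0 := by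
  intro h0
  have h1 := inner_alpha_of_le hr hm (top r) (top r)
  rw [h0, LinearMap.zero_apply, inner_zero_left, inner_top_top] at h1
  exact r.factorial_ne_zero (by exact_mod_cast h1.symm)

theorem eposicMap_mem (hr : l ≤ r) (hm : l ≤ m) :
    eposicMap r m (r + m - 2 * l) (m - l) ∈ covariantChannels (rho r) (rho m) :=
  ⟨isQuantumChannel_stinespring (inner_alpha_of_le hr hm),
    isCovariant_stinespring (isUnitaryRep_rho _) (isTensorIntertwiner_alpha_of_le hr hm)⟩

/-- The change of index is `l = m - h`; the bound `h ≤ min m n` gives `r = (m - h) + (n - h)`, so no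
subtraction truncates and `l ≤ min r m`. -/
theorem EC_eq_range (r m : ℕ) : EC r m = Set.range (fun l : Fin (min r m + 1) =>
    eposicMap r m (r + m - 2 * l) (m - l)) := by
  ext Φ
  constructor
  · rintro ⟨n, h, hh, hr, rfl⟩
    refine ⟨⟨m - h, by omega⟩, ?_⟩
    dsimp only
    congr 1 <;> omega
  · rintro ⟨l, rfl⟩
    have := l.2
    exact ⟨r + m - 2 * l, m - l, by omega, by omega, rfl⟩

variable (r m)

/-- The Kraus operators of the channel with index `l`. -/
def krausOp (l : Fin (min r m + 1)) : P (r + m - 2 * l) →ₗ[ℂ] P m →ₗ[ℂ] P r :=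
  kraus (alpha r m (r + m - 2 * l) (m - l))

/-- The family of all Kraus operators `P_m → P_r` obtained from monomials. -/
def krausFamily (i : Σ l : Fin (min r m + 1), Fin (r + m - 2 * l + 1)) : P m →ₗ[ℂ] P r :=
  krausOp r m i.1 (mono _ i.2)

variable {r m}

theorem isTensorIntertwiner_alpha_fin (l : Fin (min r m + 1)) :
    IsTensorIntertwiner (rho r) (rho m) (rho (r + m - 2 * l))
      (alpha r m (r + m - 2 * l) (m - l)) :=
  isTensorIntertwiner_alpha_of_le (by omega) (by omega)

theorem alpha_fin_ne_zero (l : Fin (min r m + 1)) :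
    alpha r m (r + m - 2 * l) (m - l) ≠ 0 :=
  alpha_ne_zero (by omega) (by omega)

theorem choiForm_krausOp_of_ne {Φ : Module.End ℂ (P r) →ₗ[ℂ] Module.End ℂ (P m)}
    (hΦ : IsCovariant (rho r) (rho m) Φ) {l k : Fin (min r m + 1)} (hlk : l ≠ k)
    (x : P (r + m - 2 * l)) (y : P (r + m - 2 * k)) :
    choiForm Φ (krausOp r m l x) (krausOp r m k y) = 0 := by
  have h : (l : ℕ) ≠ k := fun h => hlk (Fin.ext h)
  exact choiForm_kraus_of_ne hΦ (isTensorIntertwiner_alpha_fin l) (isTensorIntertwiner_alpha_fin k)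
    (by omega) x y

theorem choiForm_krausOp {Φ : Module.End ℂ (P r) →ₗ[ℂ] Module.End ℂ (P m)}
    (hΦ : IsCovariant (rho r) (rho m) Φ) (l : Fin (min r m + 1)) (x y : P (r + m - 2 * l)) :
    choiForm Φ (krausOp r m l x) (krausOp r m l y) =
      choiForm Φ (krausOp r m l (top _)) (krausOp r m l (top _)) / (r + m - 2 * l).factorial *
        inner ℂ y x :=
  choiForm_kraus hΦ (isTensorIntertwiner_alpha_fin l) x y

/-- The family is orthogonal for the Hilbert–Schmidt form, with nonzero norms. -/
theorem linearIndependent_krausFamily : LinearIndependent ℂ (krausFamily r m) := by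
  rw [Fintype.linearIndependent_iff]
  rintro g hg ⟨l, t⟩
  have h1 := LinearMap.congr_fun (congrArg (choiForm (depolarizing (P r) (P m))) hg)
    (krausFamily r m ⟨l, t⟩)
  rw [map_sum, LinearMap.sum_apply, Finset.sum_eq_single ⟨l, t⟩] at h1
  · rw [map_smul, LinearMap.smul_apply, map_zero, LinearMap.zero_apply, smul_eq_mul,
      mul_eq_zero] at h1
    refine h1.resolve_right ?_
    rw [krausFamily, choiForm_krausOp (isCovariant_depolarizing_rho r m), inner_mono, if_pos rfl]
    have h2 := choiForm_depolarizing_self_pos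
      (kraus_top_ne_zero (isTensorIntertwiner_alpha_fin l) (alpha_fin_ne_zero l))
    have h3 (k : ℕ) : (k.factorial : ℂ) ≠ 0 := by exact_mod_cast k.factorial_ne_zero
    exact mul_ne_zero (div_ne_zero h2.ne' (h3 _)) (mul_ne_zero (h3 _) (h3 _))
  · rintro ⟨k, s⟩ - hne
    rw [map_smul, LinearMap.smul_apply, krausFamily, krausFamily]
    by_cases hk : k = l
    · subst hk
      rw [choiForm_krausOp (isCovariant_depolarizing_rho r m), inner_mono, if_neg, mul_zero,
        smul_zero]
      rintro rfl
      exact hne rfl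
    · rw [choiForm_krausOp_of_ne (isCovariant_depolarizing_rho r m) hk, smul_zero]
  · simp

/-- The Clebsch–Gordan dimension count: the blocks together have the dimension of `Hom(P_m, P_r)`.
-/
theorem sum_blockDim (r m : ℕ) :
    ∑ l : Fin (min r m + 1), (r + m - 2 * (l : ℕ) + 1) = (m + 1) * (r + 1) := by
  have h : ∀ k ≤ min r m, ∑ l ∈ Finset.range (k + 1), (r + m - 2 * l + 1) =
      (k + 1) * (r + m - k + 1) := by
    intro k hk
    induction k with
    | zero => simp
    | succ k ih =>
      rw [Finset.sum_range_succ, ih (by omega)]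
      obtain ⟨d, hd⟩ := Nat.exists_eq_add_of_le (show 2 * (k + 1) ≤ r + m by omega)
      rw [hd, show 2 * (k + 1) + d - k = d + k + 2 by omega,
        show 2 * (k + 1) + d - 2 * (k + 1) = d by omega,
        show 2 * (k + 1) + d - (k + 1) = d + k + 1 by omega]
      ring
  rw [Fin.sum_univ_eq_sum_range (fun l => r + m - 2 * l + 1), h _ le_rfl]
  rcases le_total r m with hrm | hrm
  · rw [min_eq_left hrm, show r + m - r = m by omega, mul_comm]
  · rw [min_eq_right hrm, show r + m - m = r by omega]

theorem span_krausFamily : Submodule.span ℂ (Set.range (krausFamily r m)) = ⊤ := by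
  refine span_eq_top_of_card_eq linearIndependent_krausFamily ?_
  rw [finrank_P, finrank_P, ← sum_blockDim, Fintype.card_sigma]
  exact Finset.sum_congr rfl fun l _ => Fintype.card_fin _

/-- Schur's lemma leaves one scalar per block, and the blocks span; this is where a covariant map is
reduced to `min r m + 1` numbers. -/
theorem eq_zero_of_choiForm_krausOp {Φ : Module.End ℂ (P r) →ₗ[ℂ] Module.End ℂ (P m)}
    (hΦ : IsCovariant (rho r) (rho m) Φ)
    (h : ∀ l, choiForm Φ (krausOp r m l (top _)) (krausOp r m l (top _)) = 0) : Φ = 0 := by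
  have hf : ∀ i j, choiForm Φ (krausFamily r m i) (krausFamily r m j) = 0 := by
    rintro ⟨l, s⟩ ⟨k, t⟩
    rw [krausFamily, krausFamily]
    by_cases hlk : l = k
    · subst hlk
      rw [choiForm_krausOp hΦ, h, zero_div, zero_mul]
    · exact choiForm_krausOp_of_ne hΦ hlk _ _
  have hS : ∀ S j, choiForm Φ S (krausFamily r m j) = 0 := by
    intro S j
    have hmem : S ∈ Submodule.span ℂ (Set.range (krausFamily r m)) := by
      rw [span_krausFamily]; trivial
    induction hmem using Submodule.span_induction with
    | zero => simp
    | add a b _ _ ha hb => rw [map_add, LinearMap.add_apply, ha, hb, add_zero]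
    | smul c a _ ha => rw [map_smul, LinearMap.smul_apply, ha, smul_zero]
    | mem a ha =>
      obtain ⟨i, rfl⟩ := ha
      exact hf i j
  refine eq_zero_of_choiForm Φ fun S T => ?_
  have hmem : T ∈ Submodule.span ℂ (Set.range (krausFamily r m)) := by
    rw [span_krausFamily]; trivial
  induction hmem using Submodule.span_induction with
  | zero => simp
  | add a b _ _ ha hb => rw [map_add, ha, hb, add_zero]
  | smul c a _ ha => rw [map_smulₛₗ, ha, smul_zero]
  | mem a ha =>
    obtain ⟨i, rfl⟩ := ha
    exact hS S i

variable (r m)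

/-- The EPOSIC channel with index `l`. -/
def vertex (l : Fin (min r m + 1)) : Module.End ℂ (P r) →ₗ[ℂ] Module.End ℂ (P m) :=
  eposicMap r m (r + m - 2 * l) (m - l)

/-- The coordinate of a map with respect to the EPOSIC channel with index `l`. -/
def coord (l : Fin (min r m + 1)) : (Module.End ℂ (P r) →ₗ[ℂ] Module.End ℂ (P m)) →ₗ[ℂ] ℂ :=
  (choiForm (vertex r m l) (krausOp r m l (top _)) (krausOp r m l (top _)))⁻¹ •
    choiEval (krausOp r m l (top _)) (krausOp r m l (top _))

/-- The real part of `coord`, a real linear functional. -/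
def realCoord (l : Fin (min r m + 1)) :
    (Module.End ℂ (P r) →ₗ[ℂ] Module.End ℂ (P m)) →ₗ[ℝ] ℝ :=
  Complex.reLm ∘ₗ (coord r m l).restrictScalars ℝ

variable {r m}

theorem vertex_mem (l : Fin (min r m + 1)) :
    vertex r m l ∈ covariantChannels (rho r) (rho m) :=
  eposicMap_mem (by omega) (by omega)

theorem choiForm_vertex_pos (l : Fin (min r m + 1)) :
    0 < choiForm (vertex r m l) (krausOp r m l (top _)) (krausOp r m l (top _)) :=
  choiForm_stinespring_self_pos (isTensorIntertwiner_alpha_fin l) (alpha_fin_ne_zero l)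

theorem coord_apply (l : Fin (min r m + 1))
    (Φ : Module.End ℂ (P r) →ₗ[ℂ] Module.End ℂ (P m)) : coord r m l Φ =
      (choiForm (vertex r m l) (krausOp r m l (top _)) (krausOp r m l (top _)))⁻¹ *
        choiForm Φ (krausOp r m l (top _)) (krausOp r m l (top _)) := rfl

theorem choiForm_vertex_of_ne {l k : Fin (min r m + 1)} (hlk : l ≠ k) :
    choiForm (vertex r m k) (krausOp r m l (top _)) (krausOp r m l (top _)) = 0 := by
  have h : (l : ℕ) ≠ k := fun h => hlk (Fin.ext h)
  exact choiForm_stinespring_of_ne (isTensorIntertwiner_alpha_fin l)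
    (isTensorIntertwiner_alpha_fin k) (by omega) _ _

theorem coord_vertex (l k : Fin (min r m + 1)) :
    coord r m l (vertex r m k) = if l = k then 1 else 0 := by
  rw [coord_apply]
  by_cases hlk : l = k
  · subst hlk
    rw [if_pos rfl, inv_mul_cancel₀ (choiForm_vertex_pos l).ne']
  · rw [choiForm_vertex_of_ne hlk, mul_zero, if_neg hlk]

/-- Only covariance enters: the difference of the two sides is covariant and its scalar on every
block vanishes. -/
theorem eq_sum_coord {Φ : Module.End ℂ (P r) →ₗ[ℂ] Module.End ℂ (P m)}
    (hΦ : IsCovariant (rho r) (rho m) Φ) : Φ = ∑ k, coord r m k Φ • vertex r m k := by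
  rw [← sub_eq_zero]
  refine eq_zero_of_choiForm_krausOp
    (hΦ.sub (IsCovariant.sum_smul _ fun k => (vertex_mem k).2)) fun l => ?_
  have h1 (k) : coord r m k Φ * choiForm (vertex r m k) (krausOp r m l (top _))
      (krausOp r m l (top _)) = if k = l then choiForm Φ (krausOp r m l (top _))
      (krausOp r m l (top _)) else 0 := by
    by_cases hk : k = l
    · subst hk
      rw [if_pos rfl, coord_apply, mul_right_comm, inv_mul_cancel₀ (choiForm_vertex_pos k).ne',
        one_mul]
    · rw [if_neg hk, choiForm_vertex_of_ne (Ne.symm hk), mul_zero]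
  rw [choiForm_sub_sum, Finset.sum_congr rfl fun k _ => h1 k]
  simp

theorem coord_nonneg {Φ : Module.End ℂ (P r) →ₗ[ℂ] Module.End ℂ (P m)}
    (hΦ : IsCompletelyPositive Φ) (l : Fin (min r m + 1)) : 0 ≤ coord r m l Φ :=
  mul_nonneg (inv_nonneg.mpr (choiForm_vertex_pos l).le) (choiForm_nonneg hΦ _)

/-- Compare traces of the images of the identity: `Φ` and every vertex preserve the trace `r + 1`.
-/
theorem sum_coord {Φ : Module.End ℂ (P r) →ₗ[ℂ] Module.End ℂ (P m)}
    (hΦ : Φ ∈ covariantChannels (rho r) (rho m)) : ∑ l, coord r m l Φ = 1 := by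
  have h1 := congrArg (fun Ψ => LinearMap.trace ℂ (P m) (Ψ 1)) (eq_sum_coord hΦ.2)
  simp only [LinearMap.sum_apply, LinearMap.smul_apply, map_sum, map_smul, hΦ.1.2,
    (vertex_mem _).1.2, smul_eq_mul, ← Finset.sum_mul, LinearMap.trace_one, finrank_P] at h1
  have h2 : ((r + 1 : ℕ) : ℂ) ≠ 0 := by exact_mod_cast r.succ_ne_zero
  exact mul_right_cancel₀ h2 (by rw [one_mul]; exact h1.symm)

theorem ofReal_realCoord {Φ : Module.End ℂ (P r) →ₗ[ℂ] Module.End ℂ (P m)}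
    (hΦ : IsCompletelyPositive Φ) (l : Fin (min r m + 1)) :
    (realCoord r m l Φ : ℂ) = coord r m l Φ :=
  (Complex.eq_re_of_ofReal_le (r := 0) (by simpa using coord_nonneg hΦ l)).symm

end Channels

end

end EPOSIC

/-! ### Conclusion from the barycentric coordinates. -/

theorem proposition4p1 (r m : ℕ) :
    -- the extreme points of the convex set of covariant channels are the EPOSIC channels
    Convex ℝ (EPOSIC.covariantChannels (EPOSIC.rho r) (EPOSIC.rho m)) ∧
    (EPOSIC.covariantChannels (EPOSIC.rho r) (EPOSIC.rho m)).extremePoints ℝ = EPOSIC.EC r m ∧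
    EPOSIC.EC r m = Set.range (fun l : Fin (min r m + 1) =>
      EPOSIC.eposicMap r m (r + m - 2 * l) (m - l)) ∧
    -- the set is the simplex with these `min r m + 1` vertices
    AffineIndependent ℝ (fun l : Fin (min r m + 1) =>
      EPOSIC.eposicMap r m (r + m - 2 * l) (m - l)) ∧
    EPOSIC.covariantChannels (EPOSIC.rho r) (EPOSIC.rho m) =
      convexHull ℝ (Set.range (fun l : Fin (min r m + 1) =>
        EPOSIC.eposicMap r m (r + m - 2 * l) (m - l))) := by
  have hA := EPOSIC.convex_covariantChannels (EPOSIC.rho r) (EPOSIC.rho m)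
  have hc (i j) : EPOSIC.realCoord r m i (EPOSIC.vertex r m j) = if i = j then 1 else 0 := by
    change (EPOSIC.coord r m i (EPOSIC.vertex r m j)).re = _
    rw [EPOSIC.coord_vertex]
    split_ifs <;> simp
  have h0 : ∀ Φ ∈ EPOSIC.covariantChannels (EPOSIC.rho r) (EPOSIC.rho m), ∀ i,
      0 ≤ EPOSIC.realCoord r m i Φ := fun Φ hΦ i =>
    (Complex.le_def.mp (EPOSIC.coord_nonneg hΦ.1.1 i)).1
  have h1 : ∀ Φ ∈ EPOSIC.covariantChannels (EPOSIC.rho r) (EPOSIC.rho m),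
      ∑ i, EPOSIC.realCoord r m i Φ = 1 := fun Φ hΦ => by
    have h := EPOSIC.sum_coord hΦ
    simp only [← EPOSIC.ofReal_realCoord hΦ.1.1] at h
    exact_mod_cast h
  have hx : ∀ Φ ∈ EPOSIC.covariantChannels (EPOSIC.rho r) (EPOSIC.rho m),
      Φ = ∑ i, EPOSIC.realCoord r m i Φ • EPOSIC.vertex r m i := fun Φ hΦ => by
    have h := EPOSIC.eq_sum_coord hΦ.2
    simp only [← EPOSIC.ofReal_realCoord hΦ.1.1] at h
    exact h
  refine ⟨hA, ?_, EPOSIC.EC_eq_range r m, EPOSIC.affineIndependent_of_dual hc,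
    EPOSIC.eq_convexHull_of_barycentric hA EPOSIC.vertex_mem h0 h1 hx⟩
  rw [EPOSIC.EC_eq_range]
  exact EPOSIC.extremePoints_of_barycentric hA EPOSIC.vertex_mem hc h0 h1 hx
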